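/- Let $n\ge 0$ and $[n]=\{1,\dots,n\}$. **Definitions.** An *alternating sign matrix* (ASM) of order $n$ is an $n\times n$ matrix $A$ with entries in $\{-1,0,1\}$, all row and column sums equal to $1$, and whose nonzero entries alternate in sign along each row and each column. A *height function matrix* (HFM) of order $n$ is an $(n+1)\times(n+1)$ integer matrix $H=(H_{i,j})_{0\le i,j\le n}$ with $H_{0,j}=j$, $H_{i,0}=i$, $H_{n,j}=n-j$, $H_{i,n}=n-i$, and such that any two consecutive entries in a row or a column differ by $1$. The map $A\mapsto H$, $H_{i,j}=i+j-2\sum_{i'\le i,\,j'\le j}A_{i',j'}$, is a bijection from ASMs to HFMs. HFMs, ordered entrywise, form a lattice $\mathbf{HFM}_n$ (joins and meets are entrywise maxima and minima), and $\mathbf{ASM}_n$ is the lattice on ASMs obtained by transport along this bijection. Two HFMs $H,H'$ are *excedance equivalent*, $H\equiv H'$, if $H_{i,j}=H'_{i,j}$ whenever $j-i\in\{0,1\}$; two ASMs are excedance equivalent if their HFMs are. For a permutation $\sigma$ of $[n]$, let $P_\sigma$ be the permutation matrix with $(P_\sigma)_{i,j}=1$ if $i=\sigma(j)$ and $0$ otherwise.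 The *Bergeron–Gagnon excedance relation* is: $\sigma\equiv\tau$ if and only if $\{i: i\le\sigma(i)\}=\{i: i\le\tau(i)\}$ and $\{\sigma(i): i\le\sigma(i)\}=\{\tau(i): i\le\tau(i)\}$. A *Dyck path* of semilength $n$ is a path with $2n$ steps $(1,1)$ or $(1,-1)$ from $(0,0)$ to $(2n,0)$ that never goes below the horizontal axis. The *Stanley lattice* $\mathbf{Dyck}_n$ is the lattice of these paths, with $P\le Q$ if $P$ stays below $Q$. For any HFM $H$, the sequence $H_{0,0},H_{0,1},H_{1,1},H_{1,2},\dots,H_{n-1,n},H_{n,n}$ is the sequence of heights of a Dyck path; write $\pi(A)$ for the Dyck path so associated with the HFM of an ASM $A$. A *noncrossing partition* (NCP) of $[n]$ is a set $\lambda$ of pairs (arcs) $(i,j)$ with $1\le i<j\le n$ such that no two distinct arcs $(i,j),(k,\ell)\in\lambda$ satisfy $i\le k<j\le\ell$. The set $\mathbf{NCP}_n$ of these is ordered by the reflexive transitive closure of the relations $\lambda\prec\mu$ where $\lambda=\mu\setminus\{(i,i+1)\}$ with $(i,i+1)\in\mu$, or $\lambda=(\mu\setminus\{(i,k)\})\cup\{(i,j),(j,k)\}$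 with $(i,k)\in\mu$ and $i<j<k$. The NCP of a Dyck path has an arc $(i,j)$, $i<j$, exactly when step $2i$ is an up step matched with the down step $2j-1$ (that is, the path has the same height $h$ after $2i-1$ and after $2j-1$ steps, and height greater than $h$ strictly in between). Let $\boldsymbol\lambda(A)$ be the NCP of $\pi(A)$ and $D_\lambda=\{A\in\mathbf{ASM}_n:\boldsymbol\lambda(A)=\lambda\}$. For $\lambda\in\mathbf{NCP}_n$, let $\tau_\lambda$ be the permutation of $[n]$ with $\tau_\lambda(j)=i$ if $(i,j)\in\lambda$, and $\tau_\lambda(j)$ the maximum of the connected component of $j$ in $\lambda$ if $j$ is not the right endpoint of an arc of $\lambda$. **Theorem.** 1. The excedance equivalence is a lattice congruence of $\mathbf{HFM}_n$ and of $\mathbf{ASM}_n$. 2. It restricts to the Bergeron–Gagnon relation: for all permutations $\sigma,\tau$ of $[n]$, $\sigma\equiv\tau$ if and only if $P_\sigma\equiv P_\tau$. 3. The map $\lambda\mapsto D_\lambda$ is a bijection from the NCPs of $[n]$ to the excedance classes of $\mathbf{ASM}_n$. 4. For every NCP $\lambda$, the maximum of the class $D_\lambda$ is the permutation matrix $P_{\tau_\lambda}$.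 5. For all NCPs $\lambda,\mu$ of $[n]$, $\lambda\le\mu$ if and only if $D_\lambda\le D_\mu$, that is, if and only if $A\le B$ for some $A\in D_\lambda$ and $B\in D_\mu$. 6. The lattice quotient $\mathbf{ASM}_n/{\equiv}$ is isomorphic to the Stanley lattice $\mathbf{Dyck}_n$; an isomorphism, compatible with order, joins and meets, sends the class of $A$ to $\pi(A)$. -/

import Mathlib

open scoped BigOperators

/-! ### Height function matrices -/

/-- `H` is a height function matrix of order `n`; rows and columns are labelled from `0` to `n`. -/
structure IsHFM {n : ℕ} (H : Fin (n + 1) → Fin (n + 1) → ℤ) : Prop where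
  first_row : ∀ j : Fin (n + 1), H 0 j = (j : ℕ)
  first_col : ∀ i : Fin (n + 1), H i 0 = (i : ℕ)
  last_row : ∀ j : Fin (n + 1), H (Fin.last n) j = (n : ℤ) - (j : ℕ)
  last_col : ∀ i : Fin (n + 1), H i (Fin.last n) = (n : ℤ) - (i : ℕ)
  row_step : ∀ (i : Fin (n + 1)) (j : Fin n), |H i j.succ - H i j.castSucc| = 1
  col_step : ∀ (i : Fin n) (j : Fin (n + 1)), |H i.succ j - H i.castSucc j| = 1

theorem IsHFM.parity {n : ℕ} {H : Fin (n + 1) → Fin (n + 1) → ℤ} (h : IsHFM H)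
    (i j : Fin (n + 1)) : (H i j - (i : ℕ) - (j : ℕ)) % 2 = 0 := by
  induction j using Fin.induction with
  | zero => simp [h.first_col]
  | succ j ih =>
    have h1 := h.row_step i j
    rw [abs_eq (by norm_num)] at h1
    simp only [Fin.val_succ, Fin.val_castSucc] at *
    push_cast
    omega

theorem IsHFM.nonneg {n : ℕ} {H : Fin (n + 1) → Fin (n + 1) → ℤ} (h : IsHFM H)
    (i j : Fin (n + 1)) : 0 ≤ H i j := by
  have h1 : ((i : ℕ) : ℤ) - (j : ℕ) ≤ H i j := by
    induction j using Fin.induction with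
    | zero => simp [h.first_col]
    | succ j ih =>
      have h1 := h.row_step i j
      rw [abs_eq (by norm_num)] at h1
      simp only [Fin.val_succ, Fin.val_castSucc] at *
      push_cast
      omega
  have h2 : ((j : ℕ) : ℤ) - (i : ℕ) ≤ H i j := by
    clear h1
    induction i using Fin.induction with
    | zero => simp [h.first_row]
    | succ i ih =>
      have h1 := h.col_step i j
      rw [abs_eq (by norm_num)] at h1
      simp only [Fin.val_succ, Fin.val_castSucc] at *
      push_cast
      omega
  omega

theorem abs_max_step {a b c d : ℤ} (h1 : |a - b| = 1) (h2 : |c - d| = 1)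
    (h3 : (a - c) % 2 = 0) : |max a c - max b d| = 1 := by
  rw [abs_eq (by norm_num)] at *
  omega

theorem abs_min_step {a b c d : ℤ} (h1 : |a - b| = 1) (h2 : |c - d| = 1)
    (h3 : (a - c) % 2 = 0) : |min a c - min b d| = 1 := by
  rw [abs_eq (by norm_num)] at *
  omega

/-- The lattice of height function matrices of order `n`: the order is entrywise comparison, and
joins and meets are the entrywise maxima and minima. -/
def HFM (n : ℕ) : Sublattice (Fin (n + 1) → Fin (n + 1) → ℤ) where
  carrier := {H | IsHFM H}
  supClosed' := by
    intro H hH K hK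
    have hp : ∀ i j, (H i j - K i j) % 2 = 0 := fun i j => by
      have := IsHFM.parity hH i j
      have := IsHFM.parity hK i j
      omega
    exact
      { first_row := fun j => by simp [IsHFM.first_row hH, IsHFM.first_row hK]
        first_col := fun j => by simp [IsHFM.first_col hH, IsHFM.first_col hK]
        last_row := fun j => by simp [IsHFM.last_row hH, IsHFM.last_row hK]
        last_col := fun j => by simp [IsHFM.last_col hH, IsHFM.last_col hK]
        row_step := fun i j => abs_max_step (IsHFM.row_step hH i j) (IsHFM.row_step hK i j) (hp _ _)
        col_step := fun i j =>
          abs_max_step (IsHFM.col_step hH i j) (IsHFM.col_step hK i j) (hp _ _) }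
  infClosed' := by
    intro H hH K hK
    have hp : ∀ i j, (H i j - K i j) % 2 = 0 := fun i j => by
      have := IsHFM.parity hH i j
      have := IsHFM.parity hK i j
      omega
    exact
      { first_row := fun j => by simp [IsHFM.first_row hH, IsHFM.first_row hK]
        first_col := fun j => by simp [IsHFM.first_col hH, IsHFM.first_col hK]
        last_row := fun j => by simp [IsHFM.last_row hH, IsHFM.last_row hK]
        last_col := fun j => by simp [IsHFM.last_col hH, IsHFM.last_col hK]
        row_step := fun i j => abs_min_step (IsHFM.row_step hH i j) (IsHFM.row_step hK i j) (hp _ _)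
        col_step := fun i j =>
          abs_min_step (IsHFM.col_step hH i j) (IsHFM.col_step hK i j) (hp _ _) }

/-- Two height function matrices are excedance equivalent when they agree on the diagonal and on
the superdiagonal. -/
def HFM.excedance (n : ℕ) : Setoid (HFM n) where
  r H K := ∀ i j : Fin (n + 1), ((j : ℕ) = i ∨ (j : ℕ) = i + 1) → H.1 i j = K.1 i j
  iseqv :=
    ⟨fun _ _ _ _ => rfl, fun h i j hij => (h i j hij).symm,
      fun h h' i j hij => (h i j hij).trans (h' i j hij)⟩

/-! ### Alternating sign matrices -/

/-- `A` is an alternating sign matrix: entries in `{-1, 0, 1}`, row and column sums equal to `1`,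
and two consecutive nonzero entries of a row or of a column are opposite. -/
structure IsASM {n : ℕ} (A : Matrix (Fin n) (Fin n) ℤ) : Prop where
  entry : ∀ i j, A i j = -1 ∨ A i j = 0 ∨ A i j = 1
  row_sum : ∀ i, ∑ j, A i j = 1
  col_sum : ∀ j, ∑ i, A i j = 1
  row_alt : ∀ i j k, j < k → A i j ≠ 0 → A i k ≠ 0 → (∀ l, j < l → l < k → A i l = 0) →
    A i k = -A i j
  col_alt : ∀ j i k, i < k → A i j ≠ 0 → A k j ≠ 0 → (∀ l, i < l → l < k → A l j = 0) →
    A k j = -A i j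

/-- Alternating sign matrices of order `n`. -/
def ASM (n : ℕ) : Type := {A : Matrix (Fin n) (Fin n) ℤ // IsASM A}

/-- The corner sum `C i j`, the sum of the entries in the first `i` rows and first `j` columns. -/
def cornerSum {n : ℕ} (A : Matrix (Fin n) (Fin n) ℤ) (i j : ℕ) : ℤ :=
  ∑ k : Fin n, ∑ l : Fin n, if (k : ℕ) < i ∧ (l : ℕ) < j then A k l else 0

/-- The height function of `A`: `H i j = i + j - 2 * C i j` with `C` the corner sum matrix. -/
def heightFun {n : ℕ} (A : Matrix (Fin n) (Fin n) ℤ) (i j : Fin (n + 1)) : ℤ :=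
  ((i : ℕ) : ℤ) + ((j : ℕ) : ℤ) - 2 * cornerSum A i j

theorem partial_succ {n : ℕ} (a : Fin n → ℤ) (j : Fin n) :
    (∑ k : Fin n, if (k : ℕ) < j + 1 then a k else 0) =
      (∑ k : Fin n, if (k : ℕ) < j then a k else 0) + a j := by
  have h : a j = ∑ k : Fin n, if k = j then a k else 0 := by simp
  conv_rhs => rw [h, ← Finset.sum_add_distrib]
  refine Finset.sum_congr rfl fun k _ => ?_
  rcases lt_trichotomy (k : ℕ) j with h | h | h
  · have : k ≠ j := fun e => by simp [e] at h
    simp [h, this, Nat.lt_succ_of_lt h]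
  · have : k = j := Fin.ext h
    simp [this]
  · have : k ≠ j := fun e => by simp [e] at h
    have h1 : ¬ (k : ℕ) < j + 1 := by omega
    have h2 : ¬ (k : ℕ) < j := by omega
    simp only [h1, h2, this, if_false, add_zero]

/-- The partial sums of an alternating sequence of sum `1` are `0` or `1`. -/
theorem alt_partial {n : ℕ} (a : Fin n → ℤ) (hs : ∑ k, a k = 1)
    (halt : ∀ j k, j < k → a j ≠ 0 → a k ≠ 0 → (∀ l, j < l → l < k → a l = 0) → a k = -a j)
    (m : ℕ) (hm : m ≤ n) : (∑ k : Fin n, if (k : ℕ) < m then a k else 0) = 0 ∨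
      (∑ k : Fin n, if (k : ℕ) < m then a k else 0) = 1 := by
  obtain ⟨f, hf⟩ : ∃ f, ∀ k, a k ≠ 0 → (∀ l, l < k → a l = 0) → a k = f := by
    by_cases hne : ∃ k, a k ≠ 0 ∧ ∀ l, l < k → a l = 0
    · obtain ⟨k₀, h₀, h₁⟩ := hne
      refine ⟨a k₀, fun k hk hl => ?_⟩
      rcases lt_trichotomy k k₀ with h | h | h
      · exact absurd (h₁ k h) hk
      · rw [h]
      · exact absurd (hl k₀ h) h₀
    · exact ⟨0, fun k hk hl => absurd ⟨k, hk, hl⟩ hne⟩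
  have inv : ∀ m : ℕ, m ≤ n →
      ((∑ k : Fin n, if (k : ℕ) < m then a k else 0) = 0 ∧ ∀ l : Fin n, (l : ℕ) < m → a l = 0) ∨
      ∃ l : Fin n, (l : ℕ) < m ∧ a l ≠ 0 ∧ (∀ l' : Fin n, l < l' → (l' : ℕ) < m → a l' = 0) ∧
        ((a l = f ∧ (∑ k : Fin n, if (k : ℕ) < m then a k else 0) = f) ∨
          (a l = -f ∧ (∑ k : Fin n, if (k : ℕ) < m then a k else 0) = 0)) := by
    intro m
    induction m with
    | zero => intro _; left; simp
    | succ m ih =>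
      intro hm
      have hps := partial_succ a ⟨m, hm⟩
      simp only [] at hps
      have split : ∀ l : Fin n, (l : ℕ) < m + 1 → l ≠ ⟨m, hm⟩ → (l : ℕ) < m := by
        intro l hl hne
        rcases Nat.lt_succ_iff_lt_or_eq.mp hl with h | h
        · exact h
        · exact absurd (Fin.ext h) hne
      rw [hps]
      by_cases h0 : a ⟨m, hm⟩ = 0
      · rcases ih (by omega) with ⟨h1, h2⟩ | ⟨l, h1, h2, h3, h4⟩
        · left
          refine ⟨by omega, fun l hl => ?_⟩
          by_cases e : l = ⟨m, hm⟩
          · rw [e, h0]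
          · exact h2 l (split l hl e)
        · right
          refine ⟨l, by omega, h2, fun l' hl hl' => ?_, by simpa [h0] using h4⟩
          by_cases e : l' = ⟨m, hm⟩
          · rw [e, h0]
          · exact h3 l' hl (split l' hl' e)
      · right
        refine ⟨⟨m, hm⟩, by simp, h0, fun l' hl hl' => ?_, ?_⟩
        · rw [Fin.lt_def] at hl
          simp only [] at hl
          omega
        · rcases ih (by omega) with ⟨h1, h2⟩ | ⟨l, h1, h2, h3, h4⟩
          · have := hf ⟨m, hm⟩ h0 (fun l hl => h2 l hl)
            left
            omega
          · have := halt l ⟨m, hm⟩ h1 h2 h0 (fun l' hl hl' => h3 l' hl hl')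
            omega
  have hn := inv n le_rfl
  have hm' := inv m hm
  simp only [Fin.is_lt, if_true] at hn
  rw [hs] at hn
  rcases hn with ⟨h1, _⟩ | ⟨l, _, _, _, h4⟩
  · omega
  · rcases hm' with ⟨h1, _⟩ | ⟨l', _, _, _, h4'⟩
    · exact Or.inl h1
    · omega

/-- A sequence whose partial sums are `0` or `1` is alternating. -/
theorem alt_of_partial {n : ℕ} (a : Fin n → ℤ) (S : ℕ → ℤ)
    (hS : ∀ m, m ≤ n → S m = 0 ∨ S m = 1) (ha : ∀ k : Fin n, a k = S (k + 1) - S k)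
    (j k : Fin n) (hjk : j < k) (hj : a j ≠ 0) (hk : a k ≠ 0)
    (hz : ∀ l, j < l → l < k → a l = 0) : a k = -a j := by
  have hjk' : (j : ℕ) < k := hjk
  have key : ∀ m : ℕ, (j : ℕ) + 1 + m ≤ k → S (j + 1 + m) = S (j + 1) := by
    intro m
    induction m with
    | zero => intro _; rfl
    | succ m ih =>
      intro hm
      have h1 := hz ⟨j + 1 + m, by omega⟩ (by rw [Fin.lt_def]; simp only []; omega)
        (by rw [Fin.lt_def]; simp only []; omega)
      rw [ha] at h1
      have h2 := ih (by omega)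
      simp only [] at h1
      rw [← h2]
      have : S (↑j + 1 + (m + 1)) = S (↑j + 1 + m + 1) := rfl
      omega
  have h1 := key (k - (j + 1)) (by omega)
  have h2 : (j : ℕ) + 1 + (k - (j + 1)) = k := by omega
  rw [h2] at h1
  have h3 := ha j
  have h4 := ha k
  rcases hS j (by omega) with a1 | a1 <;> rcases hS (j + 1) (by omega) with a2 | a2 <;>
    rcases hS k (by omega) with a3 | a3 <;> rcases hS (k + 1) (by omega) with a4 | a4 <;> omega

theorem cornerSum_succ_right {n : ℕ} (A : Matrix (Fin n) (Fin n) ℤ) (i : ℕ) (j : Fin n) :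
    cornerSum A i (j + 1) =
      cornerSum A i j + ∑ k : Fin n, if (k : ℕ) < i then A k j else 0 := by
  unfold cornerSum
  rw [← Finset.sum_add_distrib]
  refine Finset.sum_congr rfl fun k _ => ?_
  by_cases h : (k : ℕ) < i
  · simpa [h] using partial_succ (A k) j
  · simp [h]

theorem cornerSum_transpose {n : ℕ} (A : Matrix (Fin n) (Fin n) ℤ) (i j : ℕ) :
    cornerSum A.transpose i j = cornerSum A j i := by
  unfold cornerSum
  rw [Finset.sum_comm]
  simp [and_comm]

theorem IsASM.transpose {n : ℕ} {A : Matrix (Fin n) (Fin n) ℤ} (h : IsASM A) :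
    IsASM A.transpose :=
  ⟨fun i j => h.entry j i, h.col_sum, h.row_sum, h.col_alt, h.row_alt⟩

theorem cornerSum_last {n : ℕ} {A : Matrix (Fin n) (Fin n) ℤ} (h : IsASM A) (i : ℕ)
    (hi : i ≤ n) : cornerSum A i n = i := by
  unfold cornerSum
  have : ∀ k : Fin n, (∑ l : Fin n, if (k : ℕ) < i ∧ (l : ℕ) < n then A k l else 0) =
      if (k : ℕ) < i then 1 else 0 := by
    intro k
    by_cases hk : (k : ℕ) < i
    · simp [hk, h.row_sum]
    · simp [hk]
  rw [Finset.sum_congr rfl fun k _ => this k]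
  rw [Fin.sum_univ_eq_sum_range (fun k => if k < i then (1 : ℤ) else 0) n, Finset.sum_ite]
  have : (Finset.range n).filter (fun k => k < i) = Finset.range i := by
    ext k
    simp only [Finset.mem_filter, Finset.mem_range]
    omega
  simp [this]

theorem heightFun_transpose {n : ℕ} (A : Matrix (Fin n) (Fin n) ℤ) (i j : Fin (n + 1)) :
    heightFun A.transpose i j = heightFun A j i := by
  simp only [heightFun, cornerSum_transpose]
  ring

theorem heightFun_row_step {n : ℕ} {A : Matrix (Fin n) (Fin n) ℤ} (h : IsASM A)
    (i : Fin (n + 1)) (j : Fin n) :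
    |heightFun A i j.succ - heightFun A i j.castSucc| = 1 := by
  have h1 := cornerSum_succ_right A i j
  have h2 := alt_partial (fun k => A k j) (h.col_sum j) (h.col_alt j) i (by omega)
  rw [abs_eq (by norm_num)]
  simp only [heightFun, Fin.val_succ, Fin.val_castSucc]
  push_cast
  omega

theorem isHFM_heightFun {n : ℕ} {A : Matrix (Fin n) (Fin n) ℤ} (h : IsASM A) :
    IsHFM (heightFun A) where
  first_row j := by simp [heightFun, cornerSum]
  first_col i := by simp [heightFun, cornerSum]
  last_row j := by
    rw [← heightFun_transpose]
    simp only [heightFun, Fin.val_last, cornerSum_last h.transpose _ (Nat.lt_succ_iff.mp j.2)]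
    ring
  last_col i := by
    simp only [heightFun, Fin.val_last, cornerSum_last h _ (Nat.lt_succ_iff.mp i.2)]
    ring
  row_step := heightFun_row_step h
  col_step i j := by
    rw [← heightFun_transpose, ← heightFun_transpose A]
    exact heightFun_row_step h.transpose j i

/-- The height function matrix of an alternating sign matrix. -/
def ASM.toHFM {n : ℕ} (A : ASM n) : HFM n := ⟨heightFun A.1, isHFM_heightFun A.2⟩

theorem ASM.toHFM_injective {n : ℕ} : Function.Injective (ASM.toHFM (n := n)) := by
  intro A B hAB
  have h1 : ∀ i j : ℕ, i ≤ n → j ≤ n → cornerSum A.1 i j = cornerSum B.1 i j := by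
    intro i j hi hj
    have := congrFun (congrFun (congrArg Subtype.val hAB) ⟨i, by omega⟩) ⟨j, by omega⟩
    simp only [ASM.toHFM, heightFun] at this
    omega
  apply Subtype.ext
  ext i j
  have e : ∀ A : Matrix (Fin n) (Fin n) ℤ, A i j = cornerSum A (i + 1) (j + 1) -
      cornerSum A (i + 1) j - cornerSum A i (j + 1) + cornerSum A i j := by
    intro A
    rw [cornerSum_succ_right, cornerSum_succ_right]
    have h3 : (∑ k : Fin n, if (k : ℕ) < i + 1 then A k j else 0) =
        (∑ k : Fin n, if (k : ℕ) < i then A k j else 0) + A i j :=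
      partial_succ (fun k => A k j) i
    rw [h3]
    ring
  rw [e A.1, e B.1, h1 _ _ (by omega) (by omega), h1 _ _ (by omega) (by omega),
    h1 _ _ (by omega) (by omega), h1 _ _ (by omega) (by omega)]

/-- The second differences of the corner sums attached to a height function matrix. -/
def cornerDiff {n : ℕ} (H : Fin (n + 1) → Fin (n + 1) → ℤ) : Matrix (Fin n) (Fin n) ℤ :=
  fun i j => (H i.castSucc j.succ + H i.succ j.castSucc - H i.castSucc j.castSucc -
    H i.succ j.succ) / 2

theorem IsHFM.transpose {n : ℕ} {H : Fin (n + 1) → Fin (n + 1) → ℤ} (h : IsHFM H) :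
    IsHFM (fun i j => H j i) :=
  ⟨h.first_col, h.first_row, h.last_col, h.last_row, fun i j => h.col_step j i,
    fun i j => h.row_step j i⟩

theorem cornerDiff_transpose {n : ℕ} (H : Fin (n + 1) → Fin (n + 1) → ℤ) :
    cornerDiff (fun i j => H j i) = (cornerDiff H).transpose := by
  ext i j
  simp only [cornerDiff, Matrix.transpose_apply]
  congr 1
  ring

theorem cornerDiff_partial {n : ℕ} {H : Fin (n + 1) → Fin (n + 1) → ℤ} (h : IsHFM H)
    (j : Fin n) (i : Fin (n + 1)) :
    2 * (∑ k : Fin n, if (k : ℕ) < i then cornerDiff H k j else 0) =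
      1 + H i j.castSucc - H i j.succ := by
  induction i using Fin.induction with
  | zero =>
    simp [h.first_row]
    try ring
  | succ i ih =>
    rw [Fin.val_succ, partial_succ, mul_add]
    rw [Fin.val_castSucc] at ih
    rw [ih]
    have p1 := h.parity i.castSucc j.castSucc
    have p2 := h.parity i.castSucc j.succ
    have p3 := h.parity i.succ j.castSucc
    have p4 := h.parity i.succ j.succ
    simp only [cornerDiff, Fin.val_succ, Fin.val_castSucc] at *
    push_cast at *
    omega

theorem cornerDiff_partial_mem {n : ℕ} {H : Fin (n + 1) → Fin (n + 1) → ℤ} (h : IsHFM H)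
    (j : Fin n) (m : ℕ) (hm : m ≤ n) :
    (∑ k : Fin n, if (k : ℕ) < m then cornerDiff H k j else 0) = 0 ∨
      (∑ k : Fin n, if (k : ℕ) < m then cornerDiff H k j else 0) = 1 := by
  have h1 := cornerDiff_partial h j ⟨m, by omega⟩
  have h2 := h.row_step ⟨m, by omega⟩ j
  rw [abs_eq (by norm_num)] at h2
  simp only [] at h1
  omega

theorem cornerDiff_col_sum {n : ℕ} {H : Fin (n + 1) → Fin (n + 1) → ℤ} (h : IsHFM H)
    (j : Fin n) : ∑ k, cornerDiff H k j = 1 := by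
  have h1 := cornerDiff_partial h j (Fin.last n)
  simp only [Fin.val_last, Fin.is_lt, if_true, h.last_row, Fin.val_castSucc, Fin.val_succ] at h1
  push_cast at h1
  omega

theorem cornerDiff_col_alt {n : ℕ} {H : Fin (n + 1) → Fin (n + 1) → ℤ} (h : IsHFM H)
    (j i k : Fin n) (hik : i < k) (hi : cornerDiff H i j ≠ 0) (hk : cornerDiff H k j ≠ 0)
    (hz : ∀ l, i < l → l < k → cornerDiff H l j = 0) :
    cornerDiff H k j = -cornerDiff H i j :=
  alt_of_partial (fun k => cornerDiff H k j)
    (fun m => ∑ k : Fin n, if (k : ℕ) < m then cornerDiff H k j else 0)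
    (cornerDiff_partial_mem h j)
    (fun k => eq_sub_of_add_eq' (partial_succ (fun k => cornerDiff H k j) k).symm)
    i k hik hi hk hz

theorem isASM_cornerDiff {n : ℕ} {H : Fin (n + 1) → Fin (n + 1) → ℤ} (h : IsHFM H) :
    IsASM (cornerDiff H) where
  entry i j := by
    have h1 : (∑ k : Fin n, if (k : ℕ) < i + 1 then cornerDiff H k j else 0) =
        (∑ k : Fin n, if (k : ℕ) < i then cornerDiff H k j else 0) + cornerDiff H i j :=
      partial_succ (fun k => cornerDiff H k j) i
    have h2 := cornerDiff_partial_mem h j i (by omega)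
    have h3 := cornerDiff_partial_mem h j (i + 1) (by omega)
    omega
  row_sum i := by
    have := cornerDiff_col_sum h.transpose i
    rw [cornerDiff_transpose] at this
    exact this
  col_sum := cornerDiff_col_sum h
  row_alt i j k := by
    have := cornerDiff_col_alt h.transpose i j k
    rw [cornerDiff_transpose] at this
    exact this
  col_alt := cornerDiff_col_alt h

theorem heightFun_cornerDiff {n : ℕ} {H : Fin (n + 1) → Fin (n + 1) → ℤ} (h : IsHFM H) :
    heightFun (cornerDiff H) = H := by
  ext i j
  induction j using Fin.induction with
  | zero => simp [heightFun, cornerSum, h.first_col]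
  | succ j ih =>
    have h1 := cornerSum_succ_right (cornerDiff H) i j
    have h2 := cornerDiff_partial h j i
    simp only [heightFun, Fin.val_succ, Fin.val_castSucc] at *
    push_cast
    omega

theorem ASM.toHFM_surjective {n : ℕ} : Function.Surjective (ASM.toHFM (n := n)) := fun H =>
  ⟨⟨cornerDiff H.1, isASM_cornerDiff H.2⟩, Subtype.ext (heightFun_cornerDiff H.2)⟩

/-- The bijection between alternating sign matrices and height function matrices. -/
noncomputable def ASM.equivHFM (n : ℕ) : ASM n ≃ HFM n :=
  Equiv.ofBijective ASM.toHFM ⟨ASM.toHFM_injective, ASM.toHFM_surjective⟩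

/-- The lattice of alternating sign matrices, transported from height function matrices. -/
noncomputable instance ASM.instLattice (n : ℕ) : Lattice (ASM n) where
  __ := PartialOrder.lift ASM.toHFM (ASM.toHFM_injective (n := n))
  sup A B := (ASM.equivHFM n).symm (A.toHFM ⊔ B.toHFM)
  inf A B := (ASM.equivHFM n).symm (A.toHFM ⊓ B.toHFM)
  le_sup_left _ _ := le_sup_left.trans_eq ((ASM.equivHFM n).apply_symm_apply _).symm
  le_sup_right _ _ := le_sup_right.trans_eq ((ASM.equivHFM n).apply_symm_apply _).symm
  sup_le _ _ _ h h' := ((ASM.equivHFM n).apply_symm_apply _).trans_le (sup_le h h')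
  inf_le_left _ _ := ((ASM.equivHFM n).apply_symm_apply _).trans_le inf_le_left
  inf_le_right _ _ := ((ASM.equivHFM n).apply_symm_apply _).trans_le inf_le_right
  le_inf _ _ _ h h' := (le_inf h h').trans_eq ((ASM.equivHFM n).apply_symm_apply _).symm

/-- Two alternating sign matrices are excedance equivalent when their height function matrices
agree on the diagonal and on the superdiagonal. -/
def ASM.excedance (n : ℕ) : Setoid (ASM n) := (HFM.excedance n).comap ASM.toHFM

/-- The set of classes of the excedance equivalence on alternating sign matrices. -/
def ExcedanceQuotient (n : ℕ) : Type := Quotient (ASM.excedance n)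

/-- The class of an alternating sign matrix. -/
def ASM.toQuotient {n : ℕ} (A : ASM n) : ExcedanceQuotient n := Quotient.mk (ASM.excedance n) A

/-- `X ≤ Y` if and only if `A ≤ B` for some representatives `A` of `X` and `B` of `Y`. -/
instance ExcedanceQuotient.instLE (n : ℕ) : LE (ExcedanceQuotient n) :=
  ⟨fun X Y => ∃ A B : ASM n, A.toQuotient = X ∧ B.toQuotient = Y ∧ A ≤ B⟩

/-! ### Permutations -/

/-- The permutation matrix of `σ` is an alternating sign matrix. -/
theorem isASM_perm {n : ℕ} (σ : Equiv.Perm (Fin n)) :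
    IsASM (fun i j : Fin n => if i = σ j then (1 : ℤ) else 0) where
  entry i j := by by_cases h : i = σ j <;> simp [h]
  row_sum i := by
    have : ∀ j, (i = σ j) ↔ (j = σ.symm i) := fun j => by
      rw [Equiv.eq_symm_apply]; exact eq_comm
    simp [this]
  col_sum j := by simp
  row_alt i j k hjk hj hk _ := by
    simp only [ne_eq, ite_eq_right_iff, one_ne_zero, imp_false, not_not] at hj hk
    exact absurd (σ.injective (hj.symm.trans hk)) hjk.ne
  col_alt j i k hik hi hk _ := by
    simp only [ne_eq, ite_eq_right_iff, one_ne_zero, imp_false, not_not] at hi hk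
    exact absurd (hi.trans hk.symm) hik.ne

/-- The permutation matrix `P_σ`, whose entry `1` in column `j` lies in row `σ j`. -/
def ASM.ofPerm {n : ℕ} (σ : Equiv.Perm (Fin n)) : ASM n :=
  ⟨fun i j => if i = σ j then 1 else 0, isASM_perm σ⟩

/-- The positions of the weak excedances of `σ`. -/
def excedancePositions {n : ℕ} (σ : Equiv.Perm (Fin n)) : Set (Fin n) := {i | i ≤ σ i}

/-- The values of the weak excedances of `σ`. -/
def excedanceValues {n : ℕ} (σ : Equiv.Perm (Fin n)) : Set (Fin n) :=
  {v | ∃ i, i ≤ σ i ∧ σ i = v}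

/-- The excedance relation of Bergeron and Gagnon on permutations. -/
def PermExcedance {n : ℕ} (σ τ : Equiv.Perm (Fin n)) : Prop :=
  excedancePositions σ = excedancePositions τ ∧ excedanceValues σ = excedanceValues τ

/-! ### Dyck paths -/

/-- `h` is the sequence of heights of the `2 * n + 1` integer points of a Dyck path of
semilength `n`. -/
structure IsDyckPath {n : ℕ} (h : Fin (2 * n + 1) → ℤ) : Prop where
  first : h 0 = 0
  last : h (Fin.last (2 * n)) = 0
  step : ∀ m : Fin (2 * n), |h m.succ - h m.castSucc| = 1
  nonneg : ∀ m, 0 ≤ h m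

theorem IsDyckPath.parity {n : ℕ} {h : Fin (2 * n + 1) → ℤ} (hh : IsDyckPath h)
    (m : Fin (2 * n + 1)) : (h m - (m : ℕ)) % 2 = 0 := by
  induction m using Fin.induction with
  | zero => simp [hh.first]
  | succ m ih =>
    have h1 := hh.step m
    rw [abs_eq (by norm_num)] at h1
    simp only [Fin.val_succ, Fin.val_castSucc] at *
    push_cast
    omega

/-- The Stanley lattice of Dyck paths of semilength `n`, a path being encoded by its heights:
`P ≤ Q` if and only if `P` stays below `Q`. -/
def DyckPath (n : ℕ) : Sublattice (Fin (2 * n + 1) → ℤ) where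
  carrier := {h | IsDyckPath h}
  supClosed' := by
    intro h hh k hk
    exact
      { first := by simp [IsDyckPath.first hh, IsDyckPath.first hk]
        last := by simp [IsDyckPath.last hh, IsDyckPath.last hk]
        step := fun m => abs_max_step (IsDyckPath.step hh m) (IsDyckPath.step hk m) (by
          have := IsDyckPath.parity hh m.succ
          have := IsDyckPath.parity hk m.succ
          omega)
        nonneg := fun m => le_max_of_le_left (IsDyckPath.nonneg hh m) }
  infClosed' := by
    intro h hh k hk
    exact
      { first := by simp [IsDyckPath.first hh, IsDyckPath.first hk]
        last := by simp [IsDyckPath.last hh, IsDyckPath.last hk]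
        step := fun m => abs_min_step (IsDyckPath.step hh m) (IsDyckPath.step hk m) (by
          have := IsDyckPath.parity hh m.succ
          have := IsDyckPath.parity hk m.succ
          omega)
        nonneg := fun m => le_min (IsDyckPath.nonneg hh m) (IsDyckPath.nonneg hk m) }

/-- The sequence `H 0 0, H 0 1, H 1 1, H 1 2, …, H (n - 1) n, H n n`. -/
def heightSequence {n : ℕ} (H : Fin (n + 1) → Fin (n + 1) → ℤ) (m : Fin (2 * n + 1)) : ℤ :=
  H ⟨m / 2, by omega⟩ ⟨(m + 1) / 2, by omega⟩

theorem isDyckPath_heightSequence {n : ℕ} {H : Fin (n + 1) → Fin (n + 1) → ℤ} (h : IsHFM H) :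
    IsDyckPath (heightSequence H) where
  first := by
    have := h.first_row 0
    simpa [heightSequence] using this
  last := by
    have e1 : (⟨((Fin.last (2 * n) : Fin (2 * n + 1)) : ℕ) / 2, by omega⟩ : Fin (n + 1)) =
        Fin.last n := Fin.ext (by simp)
    have e2 : (⟨((Fin.last (2 * n) : Fin (2 * n + 1)) + 1 : ℕ) / 2, by omega⟩ : Fin (n + 1)) =
        Fin.last n := Fin.ext (by simp; omega)
    rw [heightSequence, e1, e2, h.last_row]
    simp
  step m := by
    rcases Nat.even_or_odd' (m : ℕ) with ⟨k, hk | hk⟩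
    · have hkn : k < n := by omega
      have := h.row_step ⟨k, by omega⟩ ⟨k, hkn⟩
      convert this using 3
      · exact congrArg₂ H (Fin.ext (by simp; omega)) (Fin.ext (by simp; omega))
      · exact congrArg₂ H (Fin.ext (by simp; omega)) (Fin.ext (by simp; omega))
    · have hkn : k < n := by omega
      have := h.col_step ⟨k, hkn⟩ ⟨k + 1, by omega⟩
      convert this using 3
      · exact congrArg₂ H (Fin.ext (by simp; omega)) (Fin.ext (by simp; omega))
      · exact congrArg₂ H (Fin.ext (by simp; omega)) (Fin.ext (by simp; omega))
  nonneg m := h.nonneg _ _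

/-- The Dyck path of an alternating sign matrix, read on the diagonal and the superdiagonal of
its height function matrix. -/
def ASM.toDyckPath {n : ℕ} (A : ASM n) : DyckPath n :=
  ⟨heightSequence A.toHFM.1, isDyckPath_heightSequence A.toHFM.2⟩

/-! ### Noncrossing partitions -/

/-- A noncrossing partition of `{1, …, n}` (here `Fin n`), given by its set of arcs `(i, j)` with
`i < j`: no two distinct arcs cross, share their left endpoint, or share their right endpoint. -/
@[ext] structure NCP (n : ℕ) where
  arcs : Set (Fin n × Fin n)
  lt : ∀ a ∈ arcs, a.1 < a.2
  noncrossing : ∀ a ∈ arcs, ∀ b ∈ arcs, a ≠ b → ¬ (a.1 ≤ b.1 ∧ b.1 < a.2 ∧ a.2 ≤ b.2)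

/-- The generating relation of the order on noncrossing partitions: `μ` is obtained from `l` by
adding an arc `(i, i + 1)`, or by replacing two arcs `(i, j)` and `(j, k)` by the arc `(i, k)`. -/
def NCP.Step {n : ℕ} (l μ : NCP n) : Prop :=
  (∃ i j : Fin n, (j : ℕ) = i + 1 ∧ (i, j) ∈ μ.arcs ∧ l.arcs = μ.arcs \ {(i, j)}) ∨
  (∃ i j k : Fin n, i < j ∧ j < k ∧ (i, k) ∈ μ.arcs ∧
    l.arcs = (μ.arcs \ {(i, k)}) ∪ {(i, j), (j, k)})

/-- The order on noncrossing partitions. -/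
instance NCP.instLE (n : ℕ) : LE (NCP n) := ⟨Relation.ReflTransGen NCP.Step⟩

/-- The noncrossing partition of a Dyck path. The point `p` of `Fin n` sees the steps number
`2 * p + 1` and `2 * p + 2` of the path, and `(i, j)` is an arc when the second step at `i` is an up
step matched with the first step at `j`: these are the next up and down steps between two points
at the same height such that the path stays strictly above this height in between. -/
def IsDyckPath.toNCP {n : ℕ} {h : Fin (2 * n + 1) → ℤ} (_hh : IsDyckPath h) : NCP n where
  arcs := {a | a.1 < a.2 ∧ h ⟨2 * a.1 + 1, by omega⟩ = h ⟨2 * a.2 + 1, by omega⟩ ∧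
    ∀ m : Fin (2 * n + 1), 2 * (a.1 : ℕ) + 1 < m → (m : ℕ) < 2 * a.2 + 1 →
      h ⟨2 * a.1 + 1, by omega⟩ < h m}
  lt a ha := ha.1
  noncrossing := by
    rintro ⟨a, a'⟩ ⟨h1, h2, h3⟩ ⟨b, b'⟩ ⟨k1, k2, k3⟩ hne ⟨c1, c2, c3⟩
    simp only [Fin.lt_def, Fin.le_def] at *
    rcases Nat.lt_or_eq_of_le c1 with d1 | d1
    · have e1 := h3 ⟨2 * b + 1, by omega⟩ (by simp only []; omega) (by simp only []; omega)
      rcases Nat.lt_or_eq_of_le c3 with d2 | d2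
      · have e2 := k3 ⟨2 * a' + 1, by omega⟩ (by simp only []; omega) (by simp only []; omega)
        omega
      · have : a' = b' := Fin.ext d2
        subst this
        omega
    · have : a = b := Fin.ext d1
      subst this
      rcases Nat.lt_or_eq_of_le c3 with d2 | d2
      · have e2 := k3 ⟨2 * a' + 1, by omega⟩ (by simp only []; omega) (by simp only []; omega)
        omega
      · exact hne (by rw [Fin.ext d2])

/-- The noncrossing partition of an alternating sign matrix. -/
def ASM.toNCP {n : ℕ} (A : ASM n) : NCP n := IsDyckPath.toNCP A.toDyckPath.2

/-- The set `D_l` of alternating sign matrices whose noncrossing partition is `l`. -/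
def NCP.asmClass {n : ℕ} (l : NCP n) : Set (ASM n) := {A | A.toNCP = l}

/-- `j` and `k` are in the same connected component of the arc diagram `l`, in other words in the
same block of the partition. -/
def NCP.Connected {n : ℕ} (l : NCP n) (j k : Fin n) : Prop :=
  Relation.EqvGen (fun a b => (a, b) ∈ l.arcs) j k

open Classical in
/-- The maximum of the connected component of `j`. -/
noncomputable def NCP.blockMax {n : ℕ} (l : NCP n) (j : Fin n) : Fin n :=
  (Finset.univ.filter (fun k => l.Connected j k)).max'
    ⟨j, Finset.mem_filter.mpr ⟨Finset.mem_univ _, Relation.EqvGen.refl j⟩⟩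

open Classical in
/-- The map `τ_l`: it sends `j` to `i` if `(i, j)` is an arc of `l`, and to the maximum of the
connected component of `j` if `j` is not the right endpoint of an arc of `l`. -/
noncomputable def NCP.tauFun {n : ℕ} (l : NCP n) (j : Fin n) : Fin n :=
  if h : ∃ i, (i, j) ∈ l.arcs then h.choose else l.blockMax j

theorem NCP.left_unique {n : ℕ} (l : NCP n) {i j j' : Fin n} (h : (i, j) ∈ l.arcs)
    (h' : (i, j') ∈ l.arcs) : j = j' := by
  by_contra hne
  rcases lt_or_gt_of_ne hne with hlt | hlt
  · exact l.noncrossing _ h _ h' (by simpa using hne) ⟨le_rfl, l.lt _ h, hlt.le⟩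
  · exact l.noncrossing _ h' _ h (by simpa using Ne.symm hne) ⟨le_rfl, l.lt _ h', hlt.le⟩

theorem NCP.right_unique {n : ℕ} (l : NCP n) {i i' j : Fin n} (h : (i, j) ∈ l.arcs)
    (h' : (i', j) ∈ l.arcs) : i = i' := by
  by_contra hne
  rcases lt_or_gt_of_ne hne with hlt | hlt
  · exact l.noncrossing _ h _ h' (by simpa using hne) ⟨hlt.le, l.lt _ h', le_rfl⟩
  · exact l.noncrossing _ h' _ h (by simpa using Ne.symm hne) ⟨hlt.le, l.lt _ h, le_rfl⟩

open Classical in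
theorem NCP.connected_blockMax {n : ℕ} (l : NCP n) (j : Fin n) : l.Connected j (l.blockMax j) := by
  have h : l.blockMax j ∈ Finset.univ.filter (fun k => l.Connected j k) := Finset.max'_mem _ _
  exact (Finset.mem_filter.mp h).2

open Classical in
theorem NCP.le_blockMax {n : ℕ} (l : NCP n) {j k : Fin n} (h : l.Connected j k) :
    k ≤ l.blockMax j :=
  Finset.le_max' _ k (Finset.mem_filter.mpr ⟨Finset.mem_univ _, h⟩)

theorem NCP.reach_of_connected {n : ℕ} (l : NCP n) {j k : Fin n} (h : l.Connected j k)
    (m : Fin n) (hm : ¬ ∃ i, (i, m) ∈ l.arcs) :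
    Relation.ReflTransGen (fun a b => (a, b) ∈ l.arcs) m j ↔
      Relation.ReflTransGen (fun a b => (a, b) ∈ l.arcs) m k := by
  induction h with
  | rel x y hxy =>
    refine ⟨fun h => h.tail hxy, fun h => ?_⟩
    rcases Relation.ReflTransGen.cases_tail h with e | ⟨c, hc, hcy⟩
    · exact absurd ⟨x, e ▸ hxy⟩ hm
    · rwa [l.right_unique hxy hcy]
  | refl x => exact Iff.rfl
  | symm x y _ ih => exact ih.symm
  | trans x y z _ _ ih1 ih2 => exact ih1.trans ih2

theorem NCP.tauFun_injective {n : ℕ} (l : NCP n) : Function.Injective l.tauFun := by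
  intro j j' h
  have aux : ∀ i j k : Fin n, (i, j) ∈ l.arcs → l.blockMax k ≠ i := by
    intro i j k hij e
    have h1 : l.Connected k j :=
      (e ▸ l.connected_blockMax k : l.Connected k i).trans _ _ _ (Relation.EqvGen.rel _ _ hij)
    have h2 := l.le_blockMax h1
    rw [e] at h2
    exact absurd (l.lt _ hij) (not_lt.mpr h2)
  unfold NCP.tauFun at h
  split_ifs at h with h1 h2 h2
  · exact l.left_unique h1.choose_spec (h ▸ h2.choose_spec)
  · exact absurd h.symm (aux _ _ _ h1.choose_spec)
  · exact absurd h (aux _ _ _ h2.choose_spec)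
  · have hc : l.Connected j j' :=
      (h ▸ l.connected_blockMax j : l.Connected j (l.blockMax j')).trans _ _ _
        ((l.connected_blockMax j').symm)
    have := (l.reach_of_connected hc j h1).mp Relation.ReflTransGen.refl
    rcases Relation.ReflTransGen.cases_tail this with e | ⟨c, _, hc⟩
    · exact e.symm
    · exact absurd ⟨c, hc⟩ h2

/-- The permutation `τ_l`. -/
noncomputable def NCP.tau {n : ℕ} (l : NCP n) : Equiv.Perm (Fin n) :=
  Equiv.ofBijective l.tauFun (Finite.injective_iff_bijective.mp l.tauFun_injective)

/-!
Three finite objects are compared: alternating sign matrices, Dyck paths, and noncrossing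
partitions. Excedance equivalence is equality of the Dyck paths read on two diagonals of the height
matrices, and reading entries commutes with entrywise maxima and minima, so it is a congruence. The
two steps of a Dyck path at a point `p` say whether `p` is a right and a left endpoint of an arc
(`IsDyckPath.exists_arc_to_iff`, `IsDyckPath.exists_arc_from_iff`); for the path of a permutation
matrix `P_σ` they say whether `p` is a position and a value of a weak excedance of `σ`
(`permExcedance_iff`).

A noncrossing partition is determined by its left and right endpoints (`NCP.ext_of_endpoints`), and
the anti-excedances of `τ_l` are exactly the arcs of `l`. Hence the path of `P_{τ_l}` has
noncrossing partition `l`, and Dyck paths, noncrossing partitions and excedance classes are in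
bijection. That `P_{τ_l}` is the maximum of its class is proved by induction on the distance to the
diagonal. The corner sums of any alternating sign matrix grow by `0` or `1` from an entry to the
next, and off the two diagonals the height function of `P_{τ_l}` always decreases towards
at least one of the two neighbours closer to the diagonal; otherwise two arcs or two blocks
of `l` would cross (`NCP.not_crossing_antiexceedances`, `NCP.not_crossing_exceedances`).

For the order, a generating relation between noncrossing partitions is the lowering of one peak of
the path (`IsDyckPath.le_of_step`, `IsDyckPath.step_of_lower_peak`), and comparable Dyck paths are
joined by lowering peaks one at a time (`IsDyckPath.toNCP_le_of_le`). Comparable paths lift to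
comparable matrices by taking meets (`ASM.exists_le_of_toDyckPath_le`).
-/

/-! ### Heights of a Dyck path -/

/-- The height of a path after `m` steps, as a function of a natural number; it takes the junk
value `0` beyond the end of the path. -/
def pathHeight {n : ℕ} (h : Fin (2 * n + 1) → ℤ) (m : ℕ) : ℤ :=
  if hm : m < 2 * n + 1 then h ⟨m, hm⟩ else 0

theorem pathHeight_of_lt {n : ℕ} (h : Fin (2 * n + 1) → ℤ) {m : ℕ} (hm : m < 2 * n + 1) :
    pathHeight h m = h ⟨m, hm⟩ := dif_pos hm

theorem pathHeight_val {n : ℕ} (h : Fin (2 * n + 1) → ℤ) (m : Fin (2 * n + 1)) :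
    pathHeight h m = h m := dif_pos m.2

namespace IsDyckPath

variable {n : ℕ} {h k : Fin (2 * n + 1) → ℤ}

theorem pathHeight_zero (hh : IsDyckPath h) : pathHeight h 0 = 0 := by
  rw [pathHeight_of_lt h (Nat.succ_pos _)]
  exact hh.first

theorem pathHeight_last (hh : IsDyckPath h) : pathHeight h (2 * n) = 0 := by
  rw [pathHeight_of_lt h (Nat.lt_succ_self _)]
  exact hh.last

theorem pathHeight_nonneg (hh : IsDyckPath h) (m : ℕ) : 0 ≤ pathHeight h m := by
  unfold pathHeight
  split_ifs
  exacts [hh.nonneg _, le_rfl]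

theorem pathHeight_succ (hh : IsDyckPath h) {m : ℕ} (hm : m < 2 * n) :
    pathHeight h (m + 1) = pathHeight h m + 1 ∨ pathHeight h (m + 1) = pathHeight h m - 1 := by
  have h1 := hh.step ⟨m, hm⟩
  rw [abs_eq (by norm_num)] at h1
  rw [pathHeight_of_lt h (by omega : m + 1 < 2 * n + 1), pathHeight_of_lt h (by omega)]
  simp only [Fin.succ_mk, Fin.castSucc_mk] at h1
  omega

theorem pathHeight_parity (hh : IsDyckPath h) {m : ℕ} (hm : m ≤ 2 * n) :
    (pathHeight h m - m) % 2 = 0 := by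
  rw [pathHeight_of_lt h (by omega)]
  exact hh.parity ⟨m, by omega⟩

/-! ### Arcs of the noncrossing partition of a Dyck path -/

theorem mem_toNCP (hh : IsDyckPath h) {a b : Fin n} :
    (a, b) ∈ hh.toNCP.arcs ↔ a < b ∧ pathHeight h (2 * a + 1) = pathHeight h (2 * b + 1) ∧
      ∀ m : ℕ, 2 * (a : ℕ) + 1 < m → m < 2 * b + 1 →
        pathHeight h (2 * a + 1) < pathHeight h m := by
  rw [pathHeight_of_lt h (by omega : 2 * (a : ℕ) + 1 < _),
    pathHeight_of_lt h (by omega : 2 * (b : ℕ) + 1 < _)]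
  refine and_congr_right fun _ => and_congr_right fun _ =>
    ⟨fun H m h1 h2 => ?_, fun H m h1 h2 => ?_⟩
  · rw [pathHeight_of_lt h (by omega : m < _)]
    exact H ⟨m, by omega⟩ h1 h2
  · have := H m h1 h2
    rwa [pathHeight_val] at this

/-- The left endpoints of arcs are the points whose second step goes up: the arc ends at the first
return to the height before that step. -/
theorem exists_arc_from_iff (hh : IsDyckPath h) (i : Fin n) :
    (∃ j, (i, j) ∈ hh.toNCP.arcs) ↔
      pathHeight h (2 * i + 1 + 1) = pathHeight h (2 * i + 1) + 1 := by
  constructor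
  · rintro ⟨j, hj⟩
    obtain ⟨h1, -, h3⟩ := hh.mem_toNCP.mp hj
    rw [Fin.lt_def] at h1
    have := h3 (2 * i + 1 + 1) (by omega) (by omega)
    have := hh.pathHeight_succ (by omega : 2 * (i : ℕ) + 1 < 2 * n)
    omega
  · intro hup
    have hex : ∃ t, 2 * (i : ℕ) + 1 < t ∧ pathHeight h t ≤ pathHeight h (2 * i + 1) :=
      ⟨2 * n, by omega, by rw [hh.pathHeight_last]; exact hh.pathHeight_nonneg _⟩
    classical
    obtain ⟨t, ⟨ht1, ht2⟩, hmin⟩ : ∃ t, (2 * (i : ℕ) + 1 < t ∧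
        pathHeight h t ≤ pathHeight h (2 * i + 1)) ∧ ∀ m, 2 * (i : ℕ) + 1 < m → m < t →
          pathHeight h (2 * i + 1) < pathHeight h m :=
      ⟨Nat.find hex, Nat.find_spec hex, fun m h1 h2 => by
        have := Nat.find_min hex h2
        simp only [not_and, not_le] at this
        exact this h1⟩
    have htn : t ≤ 2 * n := by
      by_contra hlt
      have := hmin (2 * n) (by omega) (by omega)
      rw [hh.pathHeight_last] at this
      have := hh.pathHeight_nonneg (2 * i + 1)
      omega
    have hne : t ≠ 2 * i + 1 + 1 := by rintro rfl; omega
    obtain ⟨s, rfl⟩ : ∃ s, t = s + 1 := ⟨t - 1, by omega⟩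
    have h4 := hmin s (by omega) (by omega)
    have h5 := hh.pathHeight_succ (by omega : s < 2 * n)
    have h6 := hh.pathHeight_parity htn
    have h7 := hh.pathHeight_parity (by omega : 2 * (i : ℕ) + 1 ≤ 2 * n)
    push_cast at h6 h7
    obtain ⟨j, rfl⟩ : ∃ j, s = 2 * j := ⟨s / 2, by omega⟩
    exact ⟨⟨j, by omega⟩, hh.mem_toNCP.mpr ⟨by rw [Fin.lt_def]; simp only []; omega, by
      simp only []; omega, hmin⟩⟩

/-- The right endpoints of arcs are the points whose first step goes down: the arc starts at the
last visit to the height after that step. -/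
theorem exists_arc_to_iff (hh : IsDyckPath h) (j : Fin n) :
    (∃ i, (i, j) ∈ hh.toNCP.arcs) ↔
      pathHeight h (2 * j + 1) = pathHeight h (2 * j) - 1 := by
  constructor
  · rintro ⟨i, hi⟩
    obtain ⟨h1, h2, h3⟩ := hh.mem_toNCP.mp hi
    rw [Fin.lt_def] at h1
    have := h3 (2 * j) (by omega) (by omega)
    have := hh.pathHeight_succ (by omega : 2 * (j : ℕ) < 2 * n)
    omega
  · intro hdown
    classical
    set P : ℕ → Prop := fun t => pathHeight h t ≤ pathHeight h (2 * j + 1) with hP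
    have h0 : P 0 := by
      simp only [hP, hh.pathHeight_zero]
      exact hh.pathHeight_nonneg _
    obtain ⟨t, ht, htj, hmax⟩ : ∃ t, P t ∧ t ≤ 2 * j ∧ ∀ m, t < m → m ≤ 2 * j → ¬ P m :=
      ⟨Nat.findGreatest P (2 * j), Nat.findGreatest_spec (Nat.zero_le _) h0,
        Nat.findGreatest_le _, fun m h1 h2 => Nat.findGreatest_is_greatest h1 h2⟩
    simp only [hP, not_le] at ht hmax
    have hne : t ≠ 2 * j := by rintro rfl; omega
    have h4 := hmax (t + 1) (by omega) (by omega)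
    have h5 := hh.pathHeight_succ (by omega : t < 2 * n)
    have h6 := hh.pathHeight_parity (by omega : t ≤ 2 * n)
    have h7 := hh.pathHeight_parity (by omega : 2 * (j : ℕ) + 1 ≤ 2 * n)
    push_cast at h6 h7
    obtain ⟨i, rfl⟩ : ∃ i, t = 2 * i + 1 := ⟨t / 2, by omega⟩
    have e : pathHeight h (2 * i + 1) = pathHeight h (2 * j + 1) := by omega
    exact ⟨⟨i, by omega⟩, hh.mem_toNCP.mpr ⟨by rw [Fin.lt_def]; simp only []; omega, e,
      fun m h1 h2 => e ▸ hmax m h1 (by omega)⟩⟩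

/-- A Dyck path is determined by its noncrossing partition, whose endpoints prescribe all steps. -/
theorem toNCP_injective (hh : IsDyckPath h) (hk : IsDyckPath k) (e : hh.toNCP = hk.toNCP) :
    h = k := by
  have key : ∀ m ≤ 2 * n, pathHeight h m = pathHeight k m := by
    intro m
    induction m with
    | zero => intro _; rw [hh.pathHeight_zero, hk.pathHeight_zero]
    | succ m ih =>
      intro hm
      have h1 := ih (by omega)
      have h2 := hh.pathHeight_succ (by omega : m < 2 * n)
      have h3 := hk.pathHeight_succ (by omega : m < 2 * n)
      rcases Nat.even_or_odd' m with ⟨i, rfl | rfl⟩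
      · have h4 := hh.exists_arc_to_iff ⟨i, by omega⟩
        rw [e, hk.exists_arc_to_iff] at h4
        simp only [] at h4
        omega
      · have h4 := hh.exists_arc_from_iff ⟨i, by omega⟩
        rw [e, hk.exists_arc_from_iff] at h4
        simp only [] at h4
        omega
  funext m
  rw [← pathHeight_val h, ← pathHeight_val k, key _ (by omega)]

end IsDyckPath

/-! ### Noncrossing partitions and their endpoints -/

namespace NCP

variable {n : ℕ} {l μ : NCP n}

/-- If two noncrossing partitions have the same left endpoints and the same right endpoints, then
every arc `(i, j)` of the first is an arc of the second, by induction on its length: otherwise an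
arc of the second starting at `i` or ending at `j` has its other end strictly between `i` and `j`.
This other end belongs to an arc of the first below `(i, j)`, which is shorter, hence an arc of
the second, and two arcs of the second share an endpoint. -/
theorem mem_arcs_of_endpoints (hf : ∀ i, (∃ j, (i, j) ∈ l.arcs) ↔ ∃ j, (i, j) ∈ μ.arcs)
    (ht : ∀ j, (∃ i, (i, j) ∈ l.arcs) ↔ ∃ i, (i, j) ∈ μ.arcs) (d : ℕ) :
    ∀ i j : Fin n, (j : ℕ) - i = d → (i, j) ∈ l.arcs → (i, j) ∈ μ.arcs := by
  induction d using Nat.strong_induction_on with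
  | _ d ih =>
    intro i j hd hij
    obtain ⟨j', hj'⟩ := (hf i).mp ⟨j, hij⟩
    have hlt : i < j := l.lt _ hij
    have hlt' : i < j' := μ.lt _ hj'
    rcases lt_trichotomy j' j with h | h | h
    · obtain ⟨i', hi'⟩ := (ht j').mpr ⟨i, hj'⟩
      have h1 : i < i' := by
        by_contra hle
        exact l.noncrossing _ hi' _ hij (fun e => h.ne (congrArg Prod.snd e))
          ⟨not_lt.mp hle, hlt', h.le⟩
      have h2 : i' < j' := l.lt _ hi'
      have := ih _ (by simp only [Fin.lt_def] at *; omega) i' j' rfl hi'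
      exact absurd (μ.right_unique hj' this) h1.ne
    · rwa [← h]
    · obtain ⟨i', hi'⟩ := (ht j).mp ⟨i, hij⟩
      have h1 : i < i' := by
        by_contra hle
        exact μ.noncrossing _ hi' _ hj' (fun e => h.ne (congrArg Prod.snd e))
          ⟨not_lt.mp hle, hlt, h.le⟩
      have h2 : i' < j := μ.lt _ hi'
      obtain ⟨k, hk⟩ := (hf i').mpr ⟨j, hi'⟩
      have h3 : k < j := by
        by_contra hle
        exact l.noncrossing _ hij _ hk (fun e => h1.ne (congrArg Prod.fst e))
          ⟨h1.le, h2, not_lt.mp hle⟩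
      have h4 : i' < k := l.lt _ hk
      have := ih _ (by simp only [Fin.lt_def] at *; omega) i' k rfl hk
      exact absurd (μ.left_unique this hi') h3.ne

theorem ext_of_endpoints (hf : ∀ i, (∃ j, (i, j) ∈ l.arcs) ↔ ∃ j, (i, j) ∈ μ.arcs)
    (ht : ∀ j, (∃ i, (i, j) ∈ l.arcs) ↔ ∃ i, (i, j) ∈ μ.arcs) : l = μ := by
  ext ⟨i, j⟩
  exact ⟨mem_arcs_of_endpoints hf ht _ i j rfl,
    mem_arcs_of_endpoints (fun i => (hf i).symm) (fun j => (ht j).symm) _ i j rfl⟩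

/-! ### The permutation of a noncrossing partition -/

theorem tau_eq_of_mem {i j : Fin n} (h : (i, j) ∈ l.arcs) : l.tau j = i := by
  have hex : ∃ i, (i, j) ∈ l.arcs := ⟨i, h⟩
  change l.tauFun j = i
  rw [tauFun, dif_pos hex]
  exact l.right_unique hex.choose_spec h

theorem tau_eq_blockMax {j : Fin n} (h : ¬ ∃ i, (i, j) ∈ l.arcs) : l.tau j = l.blockMax j := by
  change l.tauFun j = _
  rw [tauFun, dif_neg h]

theorem tau_mem_of_lt {j : Fin n} (h : l.tau j < j) : (l.tau j, j) ∈ l.arcs := by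
  by_cases hex : ∃ i, (i, j) ∈ l.arcs
  · obtain ⟨i, hi⟩ := hex
    rwa [tau_eq_of_mem hi]
  · rw [tau_eq_blockMax hex] at h
    exact absurd (l.le_blockMax (Relation.EqvGen.refl j)) (not_le.mpr h)

theorem tau_lt_iff (j : Fin n) : l.tau j < j ↔ ∃ i, (i, j) ∈ l.arcs :=
  ⟨fun h => ⟨_, tau_mem_of_lt h⟩, fun ⟨_, hi⟩ => (tau_eq_of_mem hi).trans_lt (l.lt _ hi)⟩

theorem lt_tau_symm_iff (i : Fin n) : i < l.tau.symm i ↔ ∃ j, (i, j) ∈ l.arcs := by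
  constructor
  · intro h
    have := tau_mem_of_lt (l := l) (j := l.tau.symm i) (by rwa [Equiv.apply_symm_apply])
    rw [Equiv.apply_symm_apply] at this
    exact ⟨_, this⟩
  · rintro ⟨j, hj⟩
    rw [← tau_eq_of_mem hj, Equiv.symm_apply_apply, tau_eq_of_mem hj]
    exact l.lt _ hj

/-- A weak excedance of `τ_l` joins the two ends of a chain of arcs. -/
theorem reach_tau {j : Fin n} (h : j ≤ l.tau j) :
    Relation.ReflTransGen (fun a b => (a, b) ∈ l.arcs) j (l.tau j) := by
  have hj : ¬ ∃ i, (i, j) ∈ l.arcs := fun hex => absurd ((tau_lt_iff j).mpr hex) (not_lt.mpr h)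
  rw [tau_eq_blockMax hj]
  exact (l.reach_of_connected (l.connected_blockMax j) j hj).mp Relation.ReflTransGen.refl

theorem le_of_reach {j k : Fin n}
    (h : Relation.ReflTransGen (fun a b => (a, b) ∈ l.arcs) j k) : j ≤ k := by
  induction h with
  | refl => exact le_rfl
  | tail _ hab ih => exact ih.trans (l.lt _ hab).le

/-- A chain of arcs from `j` to `k` has an arc over every point between `j` and `k`. -/
theorem exists_arc_over {j k p : Fin n}
    (h : Relation.ReflTransGen (fun a b => (a, b) ∈ l.arcs) j k) (hj : j < p) (hk : p ≤ k) :
    ∃ a b, (a, b) ∈ l.arcs ∧ j ≤ a ∧ a < p ∧ p ≤ b ∧ b ≤ k := by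
  induction h with
  | refl => exact absurd hj (not_lt.mpr hk)
  | @tail x y hx hxy ih =>
    rcases lt_or_ge x p with h | h
    · exact ⟨x, y, hxy, le_of_reach hx, h, hk, le_rfl⟩
    · obtain ⟨a, b, h1, h2, h3, h4, h5⟩ := ih h
      exact ⟨a, b, h1, h2, h3, h4, h5.trans (l.lt _ hxy).le⟩

/-- The excedances of `τ_l` do not cross: otherwise the chain of arcs from `k` to `τ_l k` has an arc
over `j`, and the chain from `j` to `τ_l j` has one that crosses it. -/
theorem not_crossing_exceedances {k j : Fin n} (hkj : k < j) (hjk : j ≤ l.tau k) :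
    l.tau j ≤ l.tau k := by
  by_contra hlt
  rw [not_le] at hlt
  have hj : j ≤ l.tau j := hjk.trans hlt.le
  obtain ⟨a, b, h1, -, h3, h4, h5⟩ := exists_arc_over (reach_tau (hkj.le.trans hjk)) hkj hjk
  have h6 : j < b := lt_of_le_of_ne h4 fun e =>
    absurd ((tau_lt_iff j).mpr ⟨a, e ▸ h1⟩) (not_lt.mpr hj)
  obtain ⟨c, d, k1, k2, k3, k4, -⟩ := exists_arc_over (reach_tau hj) h6 (h5.trans hlt.le)
  exact l.noncrossing _ h1 _ k1 (fun e => (h3.trans_le k2).ne (congrArg Prod.fst e))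
    ⟨(h3.trans_le k2).le, k3, k4⟩

/-- The anti-excedances of `τ_l` do not cross, because they are the arcs of `l`. -/
theorem not_crossing_antiexceedances {k j : Fin n} (hkj : k < j) (h : l.tau k < k)
    (hjk : l.tau j < k) : l.tau j < l.tau k := by
  by_contra hle
  rw [not_lt] at hle
  exact l.noncrossing _ (tau_mem_of_lt h) _ (tau_mem_of_lt (hjk.trans hkj))
    (fun e => hkj.ne (congrArg Prod.snd e)) ⟨hle, hjk, hkj.le⟩

end NCP

/-! ### Corner sums on and off the diagonal -/

theorem cornerSum_step_right {n : ℕ} (A : ASM n) (i j : ℕ) (hi : i ≤ n) (hj : j < n) :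
    cornerSum A.1 i (j + 1) = cornerSum A.1 i j ∨
      cornerSum A.1 i (j + 1) = cornerSum A.1 i j + 1 := by
  have h1 := cornerSum_succ_right A.1 i ⟨j, hj⟩
  have h2 := alt_partial (fun k => A.1 k ⟨j, hj⟩) (A.2.col_sum _) (A.2.col_alt _) i hi
  simp only [] at h1 h2
  omega

theorem cornerSum_step_left {n : ℕ} (A : ASM n) (i j : ℕ) (hi : i < n) (hj : j ≤ n) :
    cornerSum A.1 (i + 1) j = cornerSum A.1 i j ∨
      cornerSum A.1 (i + 1) j = cornerSum A.1 i j + 1 := by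
  have := cornerSum_step_right ⟨_, A.2.transpose⟩ j i hj hi
  rwa [cornerSum_transpose, cornerSum_transpose] at this

theorem cornerSum_ofPerm_right {n : ℕ} (σ : Equiv.Perm (Fin n)) (i : ℕ) (j : Fin n) :
    cornerSum (ASM.ofPerm σ).1 i (j + 1) =
      cornerSum (ASM.ofPerm σ).1 i j + if (σ j : ℕ) < i then 1 else 0 := by
  rw [cornerSum_succ_right]
  congr 1
  have : ∀ k : Fin n, (if (k : ℕ) < i then (ASM.ofPerm σ).1 k j else 0) =
      if k = σ j then (if (σ j : ℕ) < i then 1 else 0) else 0 := by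
    intro k
    by_cases e : k = σ j
    · simp [ASM.ofPerm, e]
    · simp [ASM.ofPerm, e]
  rw [Finset.sum_congr rfl fun k _ => this k]
  simp

theorem ofPerm_transpose {n : ℕ} (σ : Equiv.Perm (Fin n)) :
    (ASM.ofPerm σ).1.transpose = (ASM.ofPerm σ.symm).1 := by
  ext i j
  change (if j = σ i then (1 : ℤ) else 0) = if i = σ.symm j then 1 else 0
  simp only [Equiv.eq_symm_apply, eq_comm]

theorem cornerSum_ofPerm_left {n : ℕ} (σ : Equiv.Perm (Fin n)) (i : Fin n) (j : ℕ) :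
    cornerSum (ASM.ofPerm σ).1 (i + 1) j =
      cornerSum (ASM.ofPerm σ).1 i j + if (σ.symm i : ℕ) < j then 1 else 0 := by
  have := cornerSum_ofPerm_right σ.symm j i
  rwa [← ofPerm_transpose, cornerSum_transpose, cornerSum_transpose] at this

theorem pathHeight_toDyckPath {n : ℕ} (A : ASM n) {m : ℕ} (hm : m ≤ 2 * n) :
    pathHeight A.toDyckPath.1 m = m - 2 * cornerSum A.1 (m / 2) ((m + 1) / 2) := by
  rw [pathHeight_of_lt _ (by omega)]
  simp only [ASM.toDyckPath, heightSequence, ASM.toHFM, heightFun]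
  omega

theorem ASM.le_iff {n : ℕ} (A B : ASM n) :
    A ≤ B ↔ ∀ i j : ℕ, i ≤ n → j ≤ n → cornerSum B.1 i j ≤ cornerSum A.1 i j := by
  change (∀ i j : Fin (n + 1), heightFun A.1 i j ≤ heightFun B.1 i j) ↔ _
  constructor
  · intro H i j hi hj
    have := H ⟨i, by omega⟩ ⟨j, by omega⟩
    simp only [heightFun] at this
    omega
  · intro H i j
    have := H i j (by omega) (by omega)
    simp only [heightFun]
    omega

theorem ASM.excedance_iff {n : ℕ} (A B : ASM n) :
    ASM.excedance n A B ↔ A.toDyckPath = B.toDyckPath := by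
  change (∀ i j : Fin (n + 1), ((j : ℕ) = i ∨ (j : ℕ) = i + 1) → A.toHFM.1 i j = B.toHFM.1 i j) ↔ _
  constructor
  · intro H
    apply Subtype.ext
    funext m
    exact H _ _ (by simp only []; omega)
  · intro H i j hij
    have h1 := congrFun (congrArg Subtype.val H) ⟨i + j, by omega⟩
    simp only [ASM.toDyckPath, heightSequence] at h1
    convert h1 using 2 <;> exact Fin.ext (by simp only []; omega)

theorem ASM.toHFM_sup {n : ℕ} (A B : ASM n) : (A ⊔ B).toHFM = A.toHFM ⊔ B.toHFM :=
  (ASM.equivHFM n).apply_symm_apply _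

theorem ASM.toHFM_inf {n : ℕ} (A B : ASM n) : (A ⊓ B).toHFM = A.toHFM ⊓ B.toHFM :=
  (ASM.equivHFM n).apply_symm_apply _

theorem ASM.toDyckPath_sup {n : ℕ} (A B : ASM n) :
    (A ⊔ B).toDyckPath = A.toDyckPath ⊔ B.toDyckPath := by
  apply Subtype.ext
  funext m
  change (A ⊔ B).toHFM.1 _ _ = _
  rw [ASM.toHFM_sup]
  rfl

theorem ASM.toDyckPath_inf {n : ℕ} (A B : ASM n) :
    (A ⊓ B).toDyckPath = A.toDyckPath ⊓ B.toDyckPath := by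
  apply Subtype.ext
  funext m
  change (A ⊓ B).toHFM.1 _ _ = _
  rw [ASM.toHFM_inf]
  rfl

theorem ASM.toDyckPath_mono {n : ℕ} {A B : ASM n} (h : A ≤ B) :
    A.toDyckPath ≤ B.toDyckPath := fun _ => h _ _

/-! ### Dyck paths of permutation matrices -/

theorem pathHeight_ofPerm_even {n : ℕ} (σ : Equiv.Perm (Fin n)) (j : Fin n) :
    pathHeight (ASM.ofPerm σ).toDyckPath.1 (2 * j + 1) =
      pathHeight (ASM.ofPerm σ).toDyckPath.1 (2 * j) + if σ j < j then -1 else 1 := by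
  rw [pathHeight_toDyckPath _ (by omega), pathHeight_toDyckPath _ (by omega)]
  have h1 := cornerSum_ofPerm_right σ j j
  have e1 : (2 * (j : ℕ) + 1) / 2 = j := by omega
  have e2 : (2 * (j : ℕ) + 1 + 1) / 2 = j + 1 := by omega
  have e3 : 2 * (j : ℕ) / 2 = j := by omega
  simp only [← Fin.lt_def] at h1
  rw [e1, e2, e3, h1]
  push_cast
  split_ifs <;> ring

theorem pathHeight_ofPerm_odd {n : ℕ} (σ : Equiv.Perm (Fin n)) (i : Fin n) :
    pathHeight (ASM.ofPerm σ).toDyckPath.1 (2 * i + 1 + 1) =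
      pathHeight (ASM.ofPerm σ).toDyckPath.1 (2 * i + 1) + if i < σ.symm i then 1 else -1 := by
  rw [pathHeight_toDyckPath _ (by omega), pathHeight_toDyckPath _ (by omega)]
  have h1 := cornerSum_ofPerm_left σ i (i + 1)
  have e1 : (2 * (i : ℕ) + 1) / 2 = i := by omega
  have e2 : (2 * (i : ℕ) + 1 + 1) / 2 = i + 1 := by omega
  have e3 : (2 * (i : ℕ) + 1 + 1 + 1) / 2 = i + 1 := by omega
  rw [e1, e2, e3, h1]
  by_cases h : i < σ.symm i
  · rw [if_pos h, if_neg (by rw [Fin.lt_def] at h; omega)]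
    push_cast
    ring
  · rw [if_neg h, if_pos (by rw [Fin.lt_def] at h; omega)]
    push_cast
    ring

theorem mem_excedanceValues_iff {n : ℕ} (σ : Equiv.Perm (Fin n)) (v : Fin n) :
    v ∈ excedanceValues σ ↔ ¬ v < σ.symm v := by
  rw [not_lt]
  constructor
  · rintro ⟨i, hi, rfl⟩
    rwa [Equiv.symm_apply_apply]
  · intro h
    exact ⟨σ.symm v, by rwa [Equiv.apply_symm_apply], Equiv.apply_symm_apply _ _⟩

/-- The steps of the Dyck path of `P_σ` record the positions and the values of the weak
excedances of `σ`. -/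
theorem permExcedance_iff {n : ℕ} (σ τ : Equiv.Perm (Fin n)) :
    PermExcedance σ τ ↔ ASM.excedance n (ASM.ofPerm σ) (ASM.ofPerm τ) := by
  rw [ASM.excedance_iff]
  constructor
  · rintro ⟨hp, hv⟩
    have key : ∀ m ≤ 2 * n, pathHeight (ASM.ofPerm σ).toDyckPath.1 m =
        pathHeight (ASM.ofPerm τ).toDyckPath.1 m := by
      intro m
      induction m with
      | zero =>
        intro _
        rw [IsDyckPath.pathHeight_zero (ASM.ofPerm σ).toDyckPath.2,
          IsDyckPath.pathHeight_zero (ASM.ofPerm τ).toDyckPath.2]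
      | succ m ih =>
        intro hm
        have h1 := ih (by omega)
        rcases Nat.even_or_odd' m with ⟨i, rfl | rfl⟩
        · have h2 := pathHeight_ofPerm_even σ ⟨i, by omega⟩
          have h3 := pathHeight_ofPerm_even τ ⟨i, by omega⟩
          have h4 := Set.ext_iff.mp hp ⟨i, by omega⟩
          simp only [excedancePositions, Set.mem_ofPred_eq, ← not_lt, not_iff_not] at h4
          simp only [h4] at h2
          simp only [] at h2 h3
          rw [h2, h3, h1]
        · have h2 := pathHeight_ofPerm_odd σ ⟨i, by omega⟩
          have h3 := pathHeight_ofPerm_odd τ ⟨i, by omega⟩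
          have h4 := Set.ext_iff.mp hv ⟨i, by omega⟩
          rw [mem_excedanceValues_iff, mem_excedanceValues_iff, not_iff_not] at h4
          simp only [h4] at h2
          simp only [] at h2 h3
          rw [h2, h3, h1]
    apply Subtype.ext
    funext m
    rw [← pathHeight_val (ASM.ofPerm σ).toDyckPath.1, ← pathHeight_val (ASM.ofPerm τ).toDyckPath.1,
      key _ (by omega)]
  · intro h
    constructor
    · ext j
      have h1 := pathHeight_ofPerm_even σ j
      have h2 := pathHeight_ofPerm_even τ j
      rw [h] at h1
      simp only [excedancePositions, Set.mem_ofPred_eq, ← not_lt, not_iff_not]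
      split_ifs at h1 h2 <;> first | tauto | omega
    · ext v
      have h1 := pathHeight_ofPerm_odd σ v
      have h2 := pathHeight_ofPerm_odd τ v
      rw [h] at h1
      rw [mem_excedanceValues_iff, mem_excedanceValues_iff, not_iff_not]
      split_ifs at h1 h2 <;> first | tauto | omega

/-! ### The maximum of an excedance class -/

theorem NCP.ofPerm_tau_mem {n : ℕ} (l : NCP n) : ASM.ofPerm l.tau ∈ l.asmClass := by
  refine NCP.ext_of_endpoints (fun i => ?_) (fun j => ?_)
  · refine (IsDyckPath.exists_arc_from_iff _ i).trans ?_
    rw [pathHeight_ofPerm_odd, ← NCP.lt_tau_symm_iff]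
    split_ifs with h <;> simp [h]
  · refine (IsDyckPath.exists_arc_to_iff _ j).trans ?_
    rw [pathHeight_ofPerm_even, ← NCP.tau_lt_iff]
    split_ifs with h <;> simp [h, sub_eq_add_neg]

theorem ASM.toNCP_eq_iff {n : ℕ} (A B : ASM n) :
    A.toNCP = B.toNCP ↔ A.toDyckPath = B.toDyckPath := by
  constructor
  · exact fun h => Subtype.ext (IsDyckPath.toNCP_injective _ _ h)
  · intro h
    unfold ASM.toNCP
    congr 1
    rw [h]

theorem ASM.exists_toDyckPath_eq {n : ℕ} (P : DyckPath n) : ∃ A : ASM n, A.toDyckPath = P :=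
  ⟨_, Subtype.ext (IsDyckPath.toNCP_injective _ _ (IsDyckPath.toNCP P.2).ofPerm_tau_mem)⟩

theorem cornerSum_eq_of_toDyckPath_eq {n : ℕ} {A B : ASM n} (h : A.toDyckPath = B.toDyckPath)
    {i j : ℕ} (hj : j ≤ n) (hij : j = i ∨ j = i + 1) :
    cornerSum A.1 i j = cornerSum B.1 i j := by
  have h1 := pathHeight_toDyckPath A (by omega : i + j ≤ 2 * n)
  have h2 := pathHeight_toDyckPath B (by omega : i + j ≤ 2 * n)
  have e1 : (i + j) / 2 = i := by omega
  have e2 : (i + j + 1) / 2 = j := by omega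
  rw [e1, e2] at h1 h2
  rw [h] at h1
  omega

/-- The class maximum above the diagonal, by induction on the distance `d` to it. One of the two
neighbours of an entry towards the diagonal has smaller height in `P_τ`, because the arcs of
`l` do not cross. -/
theorem NCP.cornerSum_tau_le_above {n : ℕ} (l : NCP n) {A : ASM n}
    (hA : (ASM.ofPerm l.tau).toDyckPath = A.toDyckPath) (d : ℕ) :
    ∀ i, i + d ≤ n →
      cornerSum (ASM.ofPerm l.tau).1 i (i + d) ≤ cornerSum A.1 i (i + d) := by
  induction d with
  | zero => exact fun i hi => (cornerSum_eq_of_toDyckPath_eq hA hi (Or.inl rfl)).le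
  | succ d ih =>
    intro i hi
    rcases Nat.eq_zero_or_pos d with rfl | hd
    · exact (cornerSum_eq_of_toDyckPath_eq hA hi (Or.inr rfl)).le
    have h1 := cornerSum_ofPerm_right l.tau i ⟨i + d, by omega⟩
    have h2 := cornerSum_ofPerm_left l.tau ⟨i, by omega⟩ (i + (d + 1))
    have h3 := cornerSum_step_right A i (i + d) (by omega) (by omega)
    have h4 := cornerSum_step_left A i (i + (d + 1)) (by omega) (by omega)
    have h5 := ih i (by omega)
    have h6 := ih (i + 1) (by omega)
    rw [show i + 1 + d = i + (d + 1) by omega] at h6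
    simp only [] at h1 h2
    rw [show i + d + 1 = i + (d + 1) by omega] at h1 h3
    split_ifs at h1 h2 with c1 c2 c2
    · omega
    · -- The arcs ending at `i + d` and starting at `i` would cross.
      have := l.not_crossing_antiexceedances (k := ⟨i + d, by omega⟩)
        (j := l.tau.symm ⟨i, by omega⟩) (by rw [Fin.lt_def]; simp only []; omega)
        (by rw [Fin.lt_def]; simp only []; omega)
        (by rw [Equiv.apply_symm_apply, Fin.lt_def]; simp only []; omega)
      rw [Equiv.apply_symm_apply, Fin.lt_def] at this
      simp only [] at this
      omega
    · omega
    · omega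

/-- The class maximum below the diagonal, by induction on the distance `d` to it. One of the two
neighbours of an entry towards the diagonal has smaller height in `P_τ`, because the blocks
of `l` do not cross. -/
theorem NCP.cornerSum_tau_le_below {n : ℕ} (l : NCP n) {A : ASM n}
    (hA : (ASM.ofPerm l.tau).toDyckPath = A.toDyckPath) (d : ℕ) :
    ∀ j, j + d ≤ n →
      cornerSum (ASM.ofPerm l.tau).1 (j + d) j ≤ cornerSum A.1 (j + d) j := by
  induction d with
  | zero => exact fun j hj => (cornerSum_eq_of_toDyckPath_eq hA hj (Or.inl rfl)).le
  | succ d ih =>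
    intro j hj
    have h1 := cornerSum_ofPerm_right l.tau (j + (d + 1)) ⟨j, by omega⟩
    have h2 := cornerSum_ofPerm_left l.tau ⟨j + d, by omega⟩ j
    have h3 := cornerSum_step_right A (j + (d + 1)) j (by omega) (by omega)
    have h4 := cornerSum_step_left A (j + d) j (by omega) (by omega)
    have h5 := ih j (by omega)
    have h6 := ih (j + 1) (by omega)
    rw [show j + 1 + d = j + (d + 1) by omega] at h6
    simp only [] at h1 h2
    rw [show j + d + 1 = j + (d + 1) by omega] at h2 h4
    split_ifs at h1 h2 with c1 c2 c2
    · omega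
    · omega
    · -- The block with maximum `j + d` and the block with minimum `j` would cross.
      have := l.not_crossing_exceedances (k := l.tau.symm ⟨j + d, by omega⟩)
        (j := ⟨j, by omega⟩) (by rw [Fin.lt_def]; simp only []; omega)
        (by rw [Equiv.apply_symm_apply, Fin.le_def]; simp only []; omega)
      rw [Equiv.apply_symm_apply, Fin.le_def] at this
      simp only [] at this
      omega
    · omega

theorem NCP.isGreatest_tau {n : ℕ} (l : NCP n) :
    IsGreatest l.asmClass (ASM.ofPerm l.tau) := by
  refine ⟨l.ofPerm_tau_mem, fun A hA => ?_⟩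
  have hA' : (ASM.ofPerm l.tau).toDyckPath = A.toDyckPath :=
    (ASM.toNCP_eq_iff _ _).mp (l.ofPerm_tau_mem.trans (Eq.symm hA))
  rw [ASM.le_iff]
  intro i j hi hj
  rcases le_total i j with h | h
  · obtain ⟨d, rfl⟩ := Nat.exists_eq_add_of_le h
    exact l.cornerSum_tau_le_above hA' d i hj
  · obtain ⟨d, rfl⟩ := Nat.exists_eq_add_of_le h
    exact l.cornerSum_tau_le_below hA' d j hi

/-! ### The order on noncrossing partitions -/

namespace IsDyckPath

variable {n : ℕ} {h k : Fin (2 * n + 1) → ℤ}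

/-- A generating relation of the order on noncrossing partitions lowers one peak of the path, since
it changes two consecutive steps. -/
theorem le_of_step (hk : IsDyckPath k) (hh : IsDyckPath h) (hs : hk.toNCP.Step hh.toNCP) :
    k ≤ h := by
  obtain ⟨c, hc⟩ : ∃ c, ∀ m ≤ 2 * n, pathHeight k m = pathHeight h m - if m = c then 2 else 0 := by
    rcases hs with ⟨i, j, hij, hmem, hl⟩ | ⟨i, j, k', hij, hjk, hmem, hl⟩
    · -- Removing `(i, i + 1)` turns the peak after `2 * i + 2` steps into a valley.
      refine ⟨2 * i + 1 + 1, fun m => ?_⟩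
      have hf : ∀ x, (∃ y, (x, y) ∈ hk.toNCP.arcs) ↔ (∃ y, (x, y) ∈ hh.toNCP.arcs) ∧ x ≠ i := by
        intro x
        rw [hl]
        constructor
        · rintro ⟨y, hy, hne⟩
          refine ⟨⟨y, hy⟩, ?_⟩
          rintro rfl
          exact hne (by rw [hh.toNCP.left_unique hy hmem]; rfl)
        · rintro ⟨⟨y, hy⟩, hne⟩
          exact ⟨y, hy, fun e => hne (congrArg Prod.fst e)⟩
      have ht : ∀ y, (∃ x, (x, y) ∈ hk.toNCP.arcs) ↔ (∃ x, (x, y) ∈ hh.toNCP.arcs) ∧ y ≠ j := by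
        intro y
        rw [hl]
        constructor
        · rintro ⟨x, hx, hne⟩
          refine ⟨⟨x, hx⟩, ?_⟩
          rintro rfl
          exact hne (by rw [hh.toNCP.right_unique hx hmem]; rfl)
        · rintro ⟨⟨x, hx⟩, hne⟩
          exact ⟨x, hx, fun e => hne (congrArg Prod.snd e)⟩
      have hup := (hh.exists_arc_from_iff i).mp ⟨j, hmem⟩
      have hdown := (hh.exists_arc_to_iff j).mp ⟨i, hmem⟩
      induction m with
      | zero =>
        intro _
        rw [hk.pathHeight_zero, hh.pathHeight_zero, if_neg (by omega), sub_zero]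
      | succ m ih =>
        intro hm
        have h1 := ih (by omega)
        have s1 := hk.pathHeight_succ (by omega : m < 2 * n)
        have s2 := hh.pathHeight_succ (by omega : m < 2 * n)
        rcases Nat.even_or_odd' m with ⟨x, rfl | rfl⟩
        · have t := ht ⟨x, by omega⟩
          rw [hk.exists_arc_to_iff, hh.exists_arc_to_iff, ne_eq, Fin.ext_iff] at t
          simp only [] at t
          by_cases e : x = j
          · subst e
            split_ifs at h1 ⊢ <;> omega
          · split_ifs at h1 ⊢ <;> omega
        · have t := hf ⟨x, by omega⟩
          rw [hk.exists_arc_from_iff, hh.exists_arc_from_iff, ne_eq, Fin.ext_iff] at t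
          simp only [] at t
          by_cases e : x = i
          · subst e
            split_ifs at h1 ⊢ <;> omega
          · split_ifs at h1 ⊢ <;> omega
    · -- The point `j`, which is on no arc of the larger partition, becomes the end of two arcs,
      -- so that the peak after `2 * j + 1` steps becomes a valley.
      refine ⟨2 * j + 1, fun m => ?_⟩
      have hij' : (i, j) ∈ hk.toNCP.arcs := by rw [hl]; exact Or.inr (Or.inl rfl)
      have hjk' : (j, k') ∈ hk.toNCP.arcs := by rw [hl]; exact Or.inr (Or.inr rfl)
      have hfj : ¬ ∃ y, (j, y) ∈ hh.toNCP.arcs := by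
        rintro ⟨y, hy⟩
        have : (j, y) ∈ hk.toNCP.arcs := by
          rw [hl]
          exact Or.inl ⟨hy, fun e => hij.ne' (congrArg Prod.fst e)⟩
        rw [hk.toNCP.left_unique this hjk'] at hy
        exact hij.ne (hh.toNCP.right_unique hmem hy)
      have htj : ¬ ∃ x, (x, j) ∈ hh.toNCP.arcs := by
        rintro ⟨x, hx⟩
        have : (x, j) ∈ hk.toNCP.arcs := by
          rw [hl]
          exact Or.inl ⟨hx, fun e => hjk.ne (congrArg Prod.snd e)⟩
        rw [hk.toNCP.right_unique this hij'] at hx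
        exact hjk.ne (hh.toNCP.left_unique hx hmem)
      have hf : ∀ x, (∃ y, (x, y) ∈ hk.toNCP.arcs) ↔ (∃ y, (x, y) ∈ hh.toNCP.arcs) ∨ x = j := by
        intro x
        by_cases e : x = i
        · subst e
          exact ⟨fun _ => Or.inl ⟨k', hmem⟩, fun _ => ⟨j, hij'⟩⟩
        by_cases e' : x = j
        · subst e'
          exact ⟨fun _ => Or.inr rfl, fun _ => ⟨k', hjk'⟩⟩
        · simp [hl, e, e']
      have ht : ∀ y, (∃ x, (x, y) ∈ hk.toNCP.arcs) ↔ (∃ x, (x, y) ∈ hh.toNCP.arcs) ∨ y = j := by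
        intro y
        by_cases e : y = k'
        · subst e
          exact ⟨fun _ => Or.inl ⟨i, hmem⟩, fun _ => ⟨j, hjk'⟩⟩
        by_cases e' : y = j
        · subst e'
          exact ⟨fun _ => Or.inr rfl, fun _ => ⟨i, hij'⟩⟩
        · simp [hl, e, e']
      rw [hh.exists_arc_from_iff] at hfj
      rw [hh.exists_arc_to_iff] at htj
      induction m with
      | zero =>
        intro _
        rw [hk.pathHeight_zero, hh.pathHeight_zero, if_neg (by omega), sub_zero]
      | succ m ih =>
        intro hm
        have h1 := ih (by omega)
        have s1 := hk.pathHeight_succ (by omega : m < 2 * n)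
        have s2 := hh.pathHeight_succ (by omega : m < 2 * n)
        rcases Nat.even_or_odd' m with ⟨x, rfl | rfl⟩
        · have t := ht ⟨x, by omega⟩
          rw [hk.exists_arc_to_iff, hh.exists_arc_to_iff, Fin.ext_iff] at t
          simp only [] at t
          by_cases e : x = j
          · subst e
            split_ifs at h1 ⊢ <;> omega
          · split_ifs at h1 ⊢ <;> omega
        · have t := hf ⟨x, by omega⟩
          rw [hk.exists_arc_from_iff, hh.exists_arc_from_iff, Fin.ext_iff] at t
          simp only [] at t
          by_cases e : x = j
          · subst e
            split_ifs at h1 ⊢ <;> omega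
          · split_ifs at h1 ⊢ <;> omega
  intro m
  have := hc m (by omega)
  rw [pathHeight_val, pathHeight_val] at this
  change k m ≤ h m
  split_ifs at this <;> omega

/-- Lowering a peak of even abscissa removes an arc between consecutive points; lowering a peak of
odd abscissa splits the innermost arc over a point in two. -/
theorem step_of_lower_peak (hh : IsDyckPath h) (hk : IsDyckPath k) {c : ℕ} (hc : c < 2 * n + 1)
    (hkc : ∀ m, pathHeight k m = pathHeight h m - if m = c then 2 else 0) :
    hk.toNCP.Step hh.toNCP := by
  have hk0 : ∀ m, m ≠ c → pathHeight k m = pathHeight h m := fun m hm => by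
    rw [hkc, if_neg hm, sub_zero]
  have hk1 : pathHeight k c = pathHeight h c - 2 := by rw [hkc, if_pos rfl]
  have hc0 : c ≠ 0 := by
    rintro rfl
    rw [hk.pathHeight_zero, hh.pathHeight_zero] at hk1
    omega
  have hcn : c ≠ 2 * n := by
    rintro rfl
    rw [hk.pathHeight_last, hh.pathHeight_last] at hk1
    omega
  obtain ⟨p, rfl⟩ : ∃ p, c = p + 1 := ⟨c - 1, by omega⟩
  have hp := hk0 p (by omega)
  have hp2 := hk0 (p + 1 + 1) (by omega)
  have s1 := hh.pathHeight_succ (by omega : p < 2 * n)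
  have s2 := hk.pathHeight_succ (by omega : p < 2 * n)
  have s3 := hh.pathHeight_succ (by omega : p + 1 < 2 * n)
  have s4 := hk.pathHeight_succ (by omega : p + 1 < 2 * n)
  rcases Nat.even_or_odd' p with ⟨x, rfl | rfl⟩
  · right
    obtain ⟨i, hi⟩ := (hk.exists_arc_to_iff ⟨x, by omega⟩).mpr (by simp only []; omega)
    obtain ⟨b, hb⟩ := (hk.exists_arc_from_iff ⟨x, by omega⟩).mpr (by simp only []; omega)
    have hfx : ∀ y, (⟨x, by omega⟩, y) ∉ hh.toNCP.arcs := fun y hy => by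
      have := (hh.exists_arc_from_iff ⟨x, by omega⟩).mp ⟨y, hy⟩
      simp only [] at this
      omega
    have htx : ∀ y, (y, ⟨x, by omega⟩) ∉ hh.toNCP.arcs := fun y hy => by
      have := (hh.exists_arc_to_iff ⟨x, by omega⟩).mp ⟨y, hy⟩
      simp only [] at this
      omega
    obtain ⟨i1, i2, i3⟩ := hk.mem_toNCP.mp hi
    obtain ⟨b1, b2, b3⟩ := hk.mem_toNCP.mp hb
    rw [Fin.lt_def] at i1 b1
    simp only [] at i1 i2 i3 b1 b2 b3
    have hib : (i, b) ∈ hh.toNCP.arcs := by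
      rw [mem_toNCP, Fin.lt_def]
      rw [hk0 (2 * i + 1) (by omega)] at i2 i3
      rw [hk0 (2 * b + 1) (by omega)] at b2
      refine ⟨by omega, by omega, fun m m1 m2 => ?_⟩
      rcases lt_trichotomy m (2 * x + 1) with e | e | e
      · have := i3 m m1 e
        rwa [hk0 m (by omega)] at this
      · rw [e]
        omega
      · have := b3 m e m2
        rw [hk0 m (by omega)] at this
        omega
    refine ⟨i, ⟨x, by omega⟩, b, i1, b1, hib, ?_⟩
    ext ⟨u, v⟩
    simp only [Set.mem_union, Set.mem_sdiff, Set.mem_insert_iff, Set.mem_singleton_iff]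
    constructor
    · intro huv
      by_cases hu : u = ⟨x, by omega⟩
      · subst hu
        exact Or.inr (Or.inr (by rw [hk.toNCP.left_unique huv hb]))
      by_cases hv : v = ⟨x, by omega⟩
      · subst hv
        exact Or.inr (Or.inl (by rw [hk.toNCP.right_unique huv hi]))
      refine Or.inl ⟨?_, fun e => ?_⟩
      · obtain ⟨c1, c2, c3⟩ := hk.mem_toNCP.mp huv
        have hu' : (u : ℕ) ≠ x := fun e => hu (Fin.ext e)
        have hv' : (v : ℕ) ≠ x := fun e => hv (Fin.ext e)
        rw [hk0 (2 * u + 1) (by omega)] at c2 c3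
        rw [hk0 (2 * v + 1) (by omega)] at c2
        refine hh.mem_toNCP.mpr ⟨c1, c2, fun m m1 m2 => ?_⟩
        have h1 := c3 m m1 m2
        have h2 := hkc m
        split_ifs at h2 <;> omega
      · obtain ⟨rfl, rfl⟩ := Prod.mk.inj e
        exact hv (hk.toNCP.left_unique huv hi)
    · rintro (⟨huv, hne⟩ | e | e)
      · have hu' : (u : ℕ) ≠ x := by rintro rfl; exact hfx _ huv
        have hv' : (v : ℕ) ≠ x := by rintro rfl; exact htx _ huv
        obtain ⟨c1, c2, c3⟩ := hh.mem_toNCP.mp huv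
        rw [Fin.lt_def] at c1
        rw [← hk0 (2 * u + 1) (by omega)] at c2 c3
        rw [← hk0 (2 * v + 1) (by omega)] at c2
        refine hk.mem_toNCP.mpr ⟨c1, c2, fun m m1 m2 => ?_⟩
        have h1 := c3 m m1 m2
        by_cases e : m = 2 * x + 1
        · subst e
          by_contra hle
          have q1 := hk.pathHeight_parity (by omega : 2 * (u : ℕ) + 1 ≤ 2 * n)
          have q2 := hk.pathHeight_parity (by omega : 2 * x + 1 ≤ 2 * n)
          push_cast at q1 q2
          -- The lowered peak would cut the arc `(u, v)`, which would thus be `(i, b)`.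
          have hux : (u, ⟨x, by omega⟩) ∈ hk.toNCP.arcs := by
            rw [mem_toNCP, Fin.lt_def]
            refine ⟨by simp only []; omega, by simp only []; omega, fun m m1 m2 => ?_⟩
            simp only [] at m2
            have := c3 m m1 (by omega)
            rwa [hk0 m (by omega)]
          have hxv : (⟨x, by omega⟩, v) ∈ hk.toNCP.arcs := by
            rw [mem_toNCP, Fin.lt_def]
            refine ⟨by simp only []; omega, by simp only []; omega, fun m m1 m2 => ?_⟩
            simp only [] at m1
            have := c3 m (by omega) m2
            simp only []
            rw [hk0 m (by omega)]
            omega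
          exact hne (by rw [hk.toNCP.right_unique hux hi, hk.toNCP.left_unique hxv hb])
        · rwa [hk0 m e]
      · obtain ⟨rfl, rfl⟩ := Prod.mk.inj e
        exact hi
      · obtain ⟨rfl, rfl⟩ := Prod.mk.inj e
        exact hb
  · left
    have hxy : ((⟨x, by omega⟩ : Fin n), (⟨x + 1, by omega⟩ : Fin n)) ∈ hh.toNCP.arcs := by
      rw [mem_toNCP, Fin.lt_def]
      simp only []
      refine ⟨by omega, ?_, fun m m1 m2 => ?_⟩
      · rw [show 2 * (x + 1) + 1 = 2 * x + 1 + 1 + 1 by omega]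
        omega
      · rw [show m = 2 * x + 1 + 1 by omega]
        omega
    refine ⟨⟨x, by omega⟩, ⟨x + 1, by omega⟩, rfl, hxy, ?_⟩
    ext ⟨u, v⟩
    simp only [Set.mem_sdiff, Set.mem_singleton_iff]
    constructor
    · intro huv
      obtain ⟨c1, c2, c3⟩ := hk.mem_toNCP.mp huv
      rw [Fin.lt_def] at c1
      refine ⟨?_, fun e => ?_⟩
      · rw [hk0 (2 * u + 1) (by omega)] at c2 c3
        rw [hk0 (2 * v + 1) (by omega)] at c2
        refine hh.mem_toNCP.mpr ⟨c1, c2, fun m m1 m2 => ?_⟩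
        have h1 := c3 m m1 m2
        have h2 := hkc m
        split_ifs at h2 <;> omega
      · obtain ⟨rfl, rfl⟩ := Prod.mk.inj e
        have := c3 (2 * x + 1 + 1) (by simp only []; omega) (by simp only []; omega)
        simp only [] at this
        omega
    · rintro ⟨huv, hne⟩
      obtain ⟨c1, c2, c3⟩ := hh.mem_toNCP.mp huv
      rw [Fin.lt_def] at c1
      have hu : (u : ℕ) ≠ x := by
        rintro rfl
        exact hne (by rw [hh.toNCP.left_unique huv hxy])
      have d3 := c3
      rw [← hk0 (2 * u + 1) (by omega)] at c2 c3
      rw [← hk0 (2 * v + 1) (by omega)] at c2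
      refine hk.mem_toNCP.mpr ⟨c1, c2, fun m m1 m2 => ?_⟩
      have h1 := c3 m m1 m2
      by_cases e : m = 2 * x + 1 + 1
      · have h2 := c3 (2 * x + 1) (by omega) (by omega)
        have q1 := hk.pathHeight_parity (by omega : 2 * (u : ℕ) + 1 ≤ 2 * n)
        have q2 := hk.pathHeight_parity (by omega : 2 * x + 1 ≤ 2 * n)
        push_cast at q1 q2
        rw [e]
        omega
      · rwa [hk0 m e]

/-- Lowering by `2` a peak that stays nonnegative gives a Dyck path. -/
theorem lower_peak (hh : IsDyckPath h) {p : ℕ} (hp : p + 1 < 2 * n)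
    (h1 : pathHeight h (p + 1) = pathHeight h p + 1)
    (h2 : pathHeight h (p + 1 + 1) = pathHeight h (p + 1) - 1)
    (h3 : 2 ≤ pathHeight h (p + 1)) :
    ∃ k : Fin (2 * n + 1) → ℤ, IsDyckPath k ∧
      ∀ m, pathHeight k m = pathHeight h m - if m = p + 1 then 2 else 0 := by
  refine ⟨fun m => h m - if (m : ℕ) = p + 1 then 2 else 0, ⟨?_, ?_, fun m => ?_, fun m => ?_⟩,
    fun m => ?_⟩
  · simp [hh.first]
  · simp only [hh.last, Fin.val_last]
    rw [if_neg (by omega), sub_zero]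
  · have hs := hh.pathHeight_succ m.2
    rw [abs_eq (by norm_num)]
    rw [← pathHeight_val h, ← pathHeight_val h]
    simp only [Fin.val_succ, Fin.val_castSucc]
    rcases lt_trichotomy (m : ℕ) p with e | e | e
    · rw [if_neg (by omega), if_neg (by omega)]
      omega
    · rw [if_pos (by omega), if_neg (by omega), e]
      omega
    · rw [if_neg (by omega)]
      by_cases e' : (m : ℕ) = p + 1
      · rw [if_pos e', e']
        omega
      · rw [if_neg e']
        omega
  · have := hh.nonneg m
    split_ifs with e
    · rw [← e, pathHeight_val] at h3
      omega
    · omega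
  · by_cases hm : m < 2 * n + 1
    · rw [pathHeight_of_lt _ hm, pathHeight_of_lt _ hm]
    · simp only [pathHeight, dif_neg hm]
      rw [if_neg (by omega), sub_zero]

/-- The highest point of `h` strictly above a smaller path `k` is a peak of `h`; lowering such peaks
one after the other leads from `h` to `k`. -/
theorem toNCP_le_of_le (hk : IsDyckPath k) (N : ℕ) :
    ∀ {h : Fin (2 * n + 1) → ℤ} (hh : IsDyckPath h), k ≤ h → ∑ m, (h m).toNat = N →
      hk.toNCP ≤ hh.toNCP := by
  induction N using Nat.strong_induction_on with
  | _ N ih =>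
    intro h hh hle hN
    by_cases hne : ∃ m, k m < h m
    swap
    · have e : k = h := funext fun m => le_antisymm (hle m) (not_lt.mp fun hlt => hne ⟨m, hlt⟩)
      subst e
      exact Relation.ReflTransGen.refl
    obtain ⟨c, hc, hmax⟩ := Finset.exists_max_image (Finset.univ.filter fun m => k m < h m) h
      (by obtain ⟨m, hm⟩ := hne; exact ⟨m, by simpa using hm⟩)
    simp only [Finset.mem_filter, Finset.mem_univ, true_and] at hc hmax
    rw [← pathHeight_val k, ← pathHeight_val h] at hc
    have hmax' : ∀ m ≤ 2 * n, pathHeight k m < pathHeight h m →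
        pathHeight h m ≤ pathHeight h c := by
      intro m hm h1
      rw [pathHeight_of_lt _ (by omega), pathHeight_of_lt _ (by omega)] at h1
      rw [pathHeight_val, pathHeight_of_lt h (by omega : m < 2 * n + 1)]
      exact hmax _ h1
    have hc0 : (c : ℕ) ≠ 0 := by
      intro e
      rw [e, hk.pathHeight_zero, hh.pathHeight_zero] at hc
      omega
    have hcn : (c : ℕ) ≠ 2 * n := by
      intro e
      rw [e, hk.pathHeight_last, hh.pathHeight_last] at hc
      omega
    have hcl := c.2
    obtain ⟨p, hp⟩ : ∃ p, (c : ℕ) = p + 1 := ⟨c - 1, by omega⟩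
    rw [hp] at hc hmax' hcl hcn
    have s1 := hh.pathHeight_succ (by omega : p < 2 * n)
    have s2 := hk.pathHeight_succ (by omega : p < 2 * n)
    have s3 := hh.pathHeight_succ (by omega : p + 1 < 2 * n)
    have s4 := hk.pathHeight_succ (by omega : p + 1 < 2 * n)
    have q1 := hh.pathHeight_parity (by omega : p + 1 ≤ 2 * n)
    have q2 := hk.pathHeight_parity (by omega : p + 1 ≤ 2 * n)
    -- At a neighbour higher than `c` by `1`, `h` would still be above `k`, against the choice of
    -- `c`: so `c` is a peak.
    have m1 := not_or_of_imp (hmax' p (by omega))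
    have m2 := not_or_of_imp (hmax' (p + 1 + 1) (by omega))
    have nn := hk.pathHeight_nonneg (p + 1)
    obtain ⟨h', hh', hlow⟩ := hh.lower_peak (by omega : p + 1 < 2 * n) (by omega) (by omega)
      (by omega)
    have hval : ∀ m, h' m = h m - if (m : ℕ) = p + 1 then 2 else 0 := fun m => by
      rw [← pathHeight_val h', hlow, pathHeight_val]
    have hcval : h' c = h c - 2 := by rw [hval, if_pos hp]
    have hle' : k ≤ h' := by
      intro m
      change k m ≤ h' m
      rw [hval]
      by_cases e : (m : ℕ) = p + 1
      · rw [if_pos e, ← pathHeight_val k, ← pathHeight_val h, e]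
        omega
      · rw [if_neg e, sub_zero]
        exact hle m
    refine Relation.ReflTransGen.tail (ih _ ?_ hh' hle' rfl)
      (hh.step_of_lower_peak hh' (by omega) hlow)
    rw [← hN]
    refine Finset.sum_lt_sum (fun m _ => ?_) ⟨c, Finset.mem_univ _, ?_⟩
    · have := hval m
      split_ifs at this <;> omega
    · have h4 := hh'.nonneg c
      omega

end IsDyckPath

theorem NCP.toDyckPath_le_of_le {n : ℕ} {l μ : NCP n} (h : l ≤ μ) :
    (ASM.ofPerm l.tau).toDyckPath ≤ (ASM.ofPerm μ.tau).toDyckPath := by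
  induction h with
  | refl => exact le_rfl
  | @tail ν μ _ hs ih =>
    rw [← show (ASM.ofPerm ν.tau).toNCP = ν from ν.ofPerm_tau_mem,
      ← show (ASM.ofPerm μ.tau).toNCP = μ from μ.ofPerm_tau_mem] at hs
    exact ih.trans (IsDyckPath.le_of_step _ _ hs)

/-- Comparable Dyck paths come from comparable alternating sign matrices: replace any preimage of
the smaller path by its meet with a preimage of the larger one. -/
theorem ASM.exists_le_of_toDyckPath_le {n : ℕ} {A B : ASM n} (h : A.toDyckPath ≤ B.toDyckPath) :
    ∃ A' : ASM n, A'.toDyckPath = A.toDyckPath ∧ A' ≤ B :=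
  ⟨A ⊓ B, by rw [ASM.toDyckPath_inf, inf_eq_left.mpr h], inf_le_right⟩

theorem NCP.le_iff_exists_asm_le {n : ℕ} (l μ : NCP n) :
    l ≤ μ ↔ ∃ A ∈ l.asmClass, ∃ B ∈ μ.asmClass, A ≤ B := by
  constructor
  · intro h
    obtain ⟨A, hA, hle⟩ := ASM.exists_le_of_toDyckPath_le (NCP.toDyckPath_le_of_le h)
    exact ⟨A, ((ASM.toNCP_eq_iff _ _).mpr hA).trans l.ofPerm_tau_mem, _, μ.ofPerm_tau_mem, hle⟩
  · rintro ⟨A, rfl, B, rfl, hle⟩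
    exact IsDyckPath.toNCP_le_of_le _ _ _ (ASM.toDyckPath_mono hle) rfl

/-! ### The congruence and its quotient -/

/-- The excedance equivalence as a lattice congruence of height function matrices. -/
def HFM.excedanceCon (n : ℕ) : LatticeCon (HFM n) where
  toSetoid := HFM.excedance n
  inf h h' i j hij := congrArg₂ min (h i j hij) (h' i j hij)
  sup h h' i j hij := congrArg₂ max (h i j hij) (h' i j hij)

/-- The excedance equivalence as a lattice congruence of alternating sign matrices. -/
noncomputable def ASM.excedanceCon (n : ℕ) : LatticeCon (ASM n) where
  toSetoid := ASM.excedance n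
  inf {A B C D} h h' := by
    change HFM.excedance n (A ⊓ C).toHFM (B ⊓ D).toHFM
    rw [ASM.toHFM_inf, ASM.toHFM_inf]
    exact (HFM.excedanceCon n).inf h h'
  sup {A B C D} h h' := by
    change HFM.excedance n (A ⊔ C).toHFM (B ⊔ D).toHFM
    rw [ASM.toHFM_sup, ASM.toHFM_sup]
    exact (HFM.excedanceCon n).sup h h'

theorem NCP.bijOn_asmClass (n : ℕ) :
    Set.BijOn (NCP.asmClass (n := n)) Set.univ (ASM.excedance n).classes := by
  refine ⟨fun l _ => ⟨ASM.ofPerm l.tau, ?_⟩, fun l _ μ _ h => ?_, ?_⟩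
  · ext A
    refine Iff.trans ?_ (ASM.excedance_iff A _).symm
    rw [← ASM.toNCP_eq_iff, show (ASM.ofPerm l.tau).toNCP = l from l.ofPerm_tau_mem]
    rfl
  · have h1 : ASM.ofPerm l.tau ∈ μ.asmClass := h ▸ l.ofPerm_tau_mem
    exact (Eq.symm l.ofPerm_tau_mem).trans h1
  · rintro _ ⟨B, rfl⟩
    refine ⟨B.toNCP, Set.mem_univ _, ?_⟩
    ext A
    exact (ASM.toNCP_eq_iff A B).trans (ASM.excedance_iff A B).symm

/-- The isomorphism from the excedance quotient to the Stanley lattice. -/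
noncomputable def excedanceQuotientIso (n : ℕ) : ExcedanceQuotient n ≃o DyckPath n where
  toEquiv := Equiv.ofBijective
    (Quotient.lift (s := ASM.excedance n) ASM.toDyckPath
      fun A B h => (ASM.excedance_iff A B).mp h) <| by
    refine ⟨?_, fun P => ?_⟩
    · rintro ⟨A⟩ ⟨B⟩ h
      exact Quotient.sound (s := ASM.excedance n) ((ASM.excedance_iff A B).mpr h)
    · obtain ⟨A, hA⟩ := ASM.exists_toDyckPath_eq P
      exact ⟨A.toQuotient, hA⟩
  map_rel_iff' := by
    rintro ⟨A⟩ ⟨B⟩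
    constructor
    · intro h
      obtain ⟨A', hA', hle⟩ := ASM.exists_le_of_toDyckPath_le (A := A) (B := B) h
      exact ⟨A', B, Quotient.sound (s := ASM.excedance n) ((ASM.excedance_iff A' A).mpr hA'),
        rfl, hle⟩
    · rintro ⟨A', B', hA, hB, hle⟩
      have h1 := (ASM.excedance_iff A' A).mp (Quotient.exact (s := ASM.excedance n) hA)
      have h2 := (ASM.excedance_iff B' B).mp (Quotient.exact (s := ASM.excedance n) hB)
      change A.toDyckPath ≤ B.toDyckPath
      rw [← h1, ← h2]
      exact ASM.toDyckPath_mono hle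

theorem mainTheorem4 (n : ℕ) :
    -- the excedance equivalence is a lattice congruence of `HFM n` and of `ASM n`
    (∃ c : LatticeCon (HFM n), c.toSetoid = HFM.excedance n) ∧
    (∃ c : LatticeCon (ASM n), c.toSetoid = ASM.excedance n) ∧
    -- it restricts to the excedance relation on permutations
    (∀ σ τ : Equiv.Perm (Fin n),
      PermExcedance σ τ ↔ ASM.excedance n (ASM.ofPerm σ) (ASM.ofPerm τ)) ∧
    -- the sets `D_l` are the classes, indexed bijectively by noncrossing partitions
    Set.BijOn (NCP.asmClass (n := n)) Set.univ (ASM.excedance n).classes ∧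
    -- the maximum of `D_l` is the permutation matrix of `τ_l`
    (∀ l : NCP n, IsGreatest l.asmClass (ASM.ofPerm l.tau)) ∧
    -- the order of the classes is the order of the noncrossing partitions
    (∀ l μ : NCP n, l ≤ μ ↔ ∃ A ∈ l.asmClass, ∃ B ∈ μ.asmClass, A ≤ B) ∧
    -- the lattice quotient is isomorphic to the Stanley lattice
    (∃ e : ExcedanceQuotient n ≃o DyckPath n,
      (∀ A : ASM n, e A.toQuotient = A.toDyckPath) ∧
      (∀ A B : ASM n, e (A ⊔ B).toQuotient = e A.toQuotient ⊔ e B.toQuotient) ∧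
      (∀ A B : ASM n, e (A ⊓ B).toQuotient = e A.toQuotient ⊓ e B.toQuotient)) := by
  exact ⟨⟨HFM.excedanceCon n, rfl⟩, ⟨ASM.excedanceCon n, rfl⟩, permExcedance_iff,
    NCP.bijOn_asmClass n, NCP.isGreatest_tau, NCP.le_iff_exists_asm_le,
    excedanceQuotientIso n, fun _ => rfl, ASM.toDyckPath_sup, ASM.toDyckPath_inf⟩
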